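/- Let $d\ge 1$. For $\phi\in\ell^1(\mathbb{Z}^d)$ (complex-valued) put $\phi^{(1)}=\phi$, $\phi^{(n)}(x)=\sum_{y\in\mathbb{Z}^d}\phi^{(n-1)}(x-y)\phi(y)$ for $n\ge 2$, and $\widehat\phi(\xi)=\sum_{x\in\mathbb{Z}^d}\phi(x)e^{ix\cdot\xi}$ for $\xi\in\mathbb{R}^d$. Let $\mathcal{S}_d$ be the set of $\phi:\mathbb{Z}^d\to\mathbb{C}$ with $\sum_x|x^\beta\phi(x)|<\infty$ for every multi-index $\beta\in\mathbb{N}^d$, and let $\Omega(\phi)=\{\xi\in(-\pi,\pi]^d:|\widehat\phi(\xi)|=1\}$. **Homogeneity.** For a linear endomorphism $E$ of $\mathbb{R}^d$ and $t>0$ let $t^E=\exp((\log t)E)$; $\{t^E\}$ is contracting if $\|t^E\|\to0$ as $t\to0^+$. For $P:\mathbb{R}^d\to\mathbb{R}$ let $\mathrm{Exp}(P)$ be the set of all $E$ with $P(t^E\xi)=tP(\xi)$ for all $t>0$, $\xi\in\mathbb{R}^d$; then $P$ is said to be homogeneous with respect to each $E\in\mathrm{Exp}(P)$. $P$ is *positive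 homogeneous* if it is continuous, $P\ge0$, $P(\xi)=0$ only for $\xi=0$, $\mathrm{Exp}(P)\ne\emptyset$ and $\{P=1\}$ is compact; all $E\in\mathrm{Exp}(P)$ then have the same trace, denoted $\mu_P$. Let $f$ be a real function on an open neighbourhood $U$ of $0$ and let $\{t^E\}$ be contracting. A continuous $f$ is *subhomogeneous with respect to $E$* if for all $\epsilon>0$ and compact $K\subseteq\mathbb{R}^d$ there is $\tau>0$ with $|f(t^E\xi)|\le\epsilon t$ for all $0<t<\tau$, $\xi\in K$. A function $f\in C^l(U)$ is *strongly subhomogeneous with respect to $E$ of order $l$* if likewise $|t^k\partial_t^kf(t^E\xi)|\le\epsilon t$ for all $k=0,\dots,l$, $0<t<\tau$, $\xi\in K$. **Types.** Let $\phi\in\mathcal{S}_d$ with $\sup_\xi|\widehat\phi(\xi)|=1$ and $\xi_0\in\Omega(\phi)$. Consider expansions, on an open convex neighbourhood $U$ of $0$ on which the quotient below avoids $(-\infty,0]$, $$\log\frac{\widehat\phi(\xi+\xi_0)}{\widehat\phi(\xi_0)}=i\alpha\cdot\xi-i\big(Q(\xi)+\widetilde Q(\xi)\big)-\big(R(\xi)+\widetilde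 R(\xi)\big)\qquad(\xi\in U),$$ where $\log$ is the principal logarithm, $\alpha\in\mathbb{R}^d$ (the drift), $Q,R$ are real polynomials without constant and linear terms, and $\widetilde Q,\widetilde R$ are real-valued, smooth on $U$ and vanish at $0$. With such an expansion, $\xi_0$ is * of *positive homogeneous type* if $R$ is positive homogeneous and there is $E\in\mathrm{Exp}(R)\cap\mathrm{Exp}(Q)$ such that $\widetilde R$ and $\widetilde Q$ are subhomogeneous with respect to $E$; then put $P=R+iQ$ and $\mu=\mu_R$; * of *imaginary homogeneous type* if $|Q|$ and $R$ are positive homogeneous and there are $E\in\mathrm{Exp}(|Q|)$ and a real $k>1$ such that $R$ is homogeneous with respect to $E/k$, $\widetilde Q$ is strongly subhomogeneous with respect to $E$ of order $2$, and $\widetilde R$ is strongly subhomogeneous with respect to $E/k$ of order $1$; then put $\mu=\mu_{|Q|}$. **Theorem.** Let $\phi\in\mathcal{S}_d$ with $\sup_\xi|\widehat\phi(\xi)|=1$ and $\Omega(\phi)=\{\xi_0\}$. 1. If $\xi_0$ is of positive homogeneous type, with associated $\alpha$, $P$, $\mu$ as above, then the integral $$H_P^t(x)=\frac1{(2\pi)^d}\int_{\mathbb{R}^d}e^{-tP(\xi)}e^{-ix\cdot\xi}\,d\xi$$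 converges absolutely for all $t>0$, $x\in\mathbb{R}^d$, and $$\phi^{(n)}(x)=\widehat\phi(\xi_0)^ne^{-ix\cdot\xi_0}H_P^n(x-n\alpha)+o(n^{-\mu})\qquad(n\to\infty)$$ uniformly for $x\in\mathbb{Z}^d$. 2. If $\xi_0$ is of imaginary homogeneous type, with associated $\alpha$, $Q$, $\mu$ as above, and if $\mu<1$, then the limit $$H_{iQ}^t(x)=\frac1{(2\pi)^d}\lim_{\tau\to\infty}\int_{\{\xi\,:\,|Q(\xi)|<\tau\}}e^{-itQ(\xi)}e^{-ix\cdot\xi}\,d\xi$$ exists for all $t>0$, $x\in\mathbb{R}^d$; moreover $\mathrm{Exp}(Q)=\mathrm{Exp}(|Q|)$, and for each compact $K\subseteq\mathbb{R}^d$ and each $E\in\mathrm{Exp}(Q)$, $$\phi^{(n)}(x)=\widehat\phi(\xi_0)^ne^{-ix\cdot\xi_0}H_{iQ}^n(x-n\alpha)+o(n^{-\mu})\qquad(n\to\infty)$$ uniformly for $x\in\big(n\alpha+n^{E^*}(K)\big)\cap\mathbb{Z}^d$, where $E^*$ is the adjoint of $E$. -/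

import Mathlib

open scoped ContDiff

noncomputable section

namespace LocalLimit

/-- Euclidean space `ℝ^d`. -/
abbrev Space (d : ℕ) : Type := EuclideanSpace ℝ (Fin d)

/-- The integer lattice `ℤ^d`. -/
abbrev IntLattice (d : ℕ) : Type := Fin d → ℤ

/-- The inclusion of `ℤ^d` in `ℝ^d`. -/
def latticePoint {d : ℕ} (x : IntLattice d) : Space d :=
  WithLp.toLp 2 fun i => (x i : ℝ)

/-! ### Functions on the lattice, convolution powers, Fourier transform -/

/-- The class `𝓢_d`: all moments `∑ₓ |x^β φ(x)|` are finite (`β = 0` gives `φ ∈ ℓ¹(ℤ^d)`). -/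
def MemS {d : ℕ} (φ : IntLattice d → ℂ) : Prop :=
  ∀ β : Fin d → ℕ, Summable fun x : IntLattice d => ‖(∏ i, ((x i : ℂ) ^ β i)) * φ x‖

/-- The convolution powers `φ^{(n)}`: `φ^{(1)} = φ` and
`φ^{(n)}(x) = ∑_y φ^{(n-1)}(x - y) φ(y)` for `n ≥ 2`. (The value at `n = 0`, the unit mass
at the origin, is a convention that plays no role.) -/
def convPow {d : ℕ} (φ : IntLattice d → ℂ) : ℕ → IntLattice d → ℂ
  | 0 => Pi.single 0 1
  | 1 => φ
  | n + 2 => fun x => ∑' y : IntLattice d, convPow φ (n + 1) (x - y) * φ y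

/-- The Fourier transform `φ̂(ξ) = ∑ₓ φ(x) e^{i x·ξ}`. -/
def fourierSeries {d : ℕ} (φ : IntLattice d → ℂ) (ξ : Space d) : ℂ :=
  ∑' x : IntLattice d, φ x * Complex.exp (Complex.I * (inner ℝ (latticePoint x) ξ : ℝ))

/-- `Ω(φ)`: the points of `𝕋^d = (-π, π]^d` at which `|φ̂| = 1`. -/
def Omega {d : ℕ} (φ : IntLattice d → ℂ) : Set (Space d) :=
  {ξ | (∀ i, ξ i ∈ Set.Ioc (-Real.pi) Real.pi) ∧ ‖fourierSeries φ ξ‖ = 1}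

/-- `Γ_{ξ₀}(ξ) = log (φ̂(ξ + ξ₀) / φ̂(ξ₀))`, with the principal branch of the logarithm. -/
def Gam {d : ℕ} (φ : IntLattice d → ℂ) (ξ₀ ξ : Space d) : ℂ :=
  Complex.log (fourierSeries φ (ξ + ξ₀) / fourierSeries φ ξ₀)

/-! ### One-parameter groups, homogeneous and subhomogeneous functions -/

/-- `t^E = exp((log t) E)`, used for `t > 0`. -/
def tpow {d : ℕ} (t : ℝ) (E : Space d →L[ℝ] Space d) : Space d →L[ℝ] Space d :=
  NormedSpace.exp (Real.log t • E)

/-- The group `{t^E}` is contracting: `‖t^E‖ → 0` as `t → 0⁺`. -/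
def IsContracting {d : ℕ} (E : Space d →L[ℝ] Space d) : Prop :=
  Filter.Tendsto (fun t : ℝ => ‖tpow t E‖) (nhdsWithin 0 (Set.Ioi 0)) (nhds 0)

/-- `Exp(P)`: the `E` with `P(t^E ξ) = t P(ξ)` for all `t > 0` and all `ξ`. -/
def exponentSet {d : ℕ} (P : Space d → ℝ) : Set (Space d →L[ℝ] Space d) :=
  {E | ∀ t : ℝ, 0 < t → ∀ ξ, P (tpow t E ξ) = t * P ξ}

/-- Positive homogeneous functions: continuous, positive definite, with nonempty exponent set
and compact unital level set `{P = 1}`. -/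
structure IsPositiveHomogeneous {d : ℕ} (P : Space d → ℝ) : Prop where
  continuous : Continuous P
  nonneg : ∀ ξ, 0 ≤ P ξ
  eq_zero : ∀ ξ, P ξ = 0 → ξ = 0
  exponentSet_nonempty : (exponentSet P).Nonempty
  isCompact_level : IsCompact {η | P η = 1}

open Classical in
/-- The homogeneous order `μ_P`: the trace of an element of `Exp(P)` (for a positive homogeneous
`P`, all elements of `Exp(P)` have the same trace). -/
def homOrder {d : ℕ} (P : Space d → ℝ) : ℝ :=
  if h : (exponentSet P).Nonempty then
    LinearMap.trace ℝ (Space d) (h.choose : Space d →ₗ[ℝ] Space d)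
  else 0

/-- `f`, defined and continuous on the open neighbourhood `U` of `0`, is subhomogeneous with
respect to `E`, where `{t^E}` is contracting. -/
def IsSubhomogeneous {d : ℕ} (U : Set (Space d)) (f : Space d → ℝ)
    (E : Space d →L[ℝ] Space d) : Prop :=
  IsContracting E ∧ ContinuousOn f U ∧
    ∀ ε : ℝ, 0 < ε → ∀ K : Set (Space d), IsCompact K →
      ∃ τ : ℝ, 0 < τ ∧ ∀ t : ℝ, 0 < t → t < τ → ∀ ξ ∈ K,
        tpow t E ξ ∈ U ∧ |f (tpow t E ξ)| ≤ ε * t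

/-- `f ∈ C^l(U)` is strongly subhomogeneous with respect to `E` of order `l`, where `{t^E}` is
contracting: `|t^k ∂_t^k f(t^E ξ)| ≤ ε t` for `k = 0, …, l`, uniformly for `ξ` in compact sets,
for small `t > 0`. -/
def IsStronglySubhomogeneous {d : ℕ} (U : Set (Space d)) (f : Space d → ℝ)
    (E : Space d →L[ℝ] Space d) (l : ℕ) : Prop :=
  IsContracting E ∧ ContDiffOn ℝ l f U ∧
    ∀ ε : ℝ, 0 < ε → ∀ K : Set (Space d), IsCompact K →
      ∃ τ : ℝ, 0 < τ ∧ ∀ t : ℝ, 0 < t → t < τ → ∀ ξ ∈ K,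
        tpow t E ξ ∈ U ∧ ∀ k : ℕ, k ≤ l →
          |t ^ k * iteratedDeriv k (fun s : ℝ => f (tpow s E ξ)) t| ≤ ε * t

/-! ### Local expansions and types of points -/

/-- The function on `ℝ^d` given by a real polynomial in `d` variables. -/
def polyFun {d : ℕ} (p : MvPolynomial (Fin d) ℝ) (ξ : Space d) : ℝ :=
  MvPolynomial.eval (fun i => ξ i) p

/-- An expansion
`Γ_{ξ₀}(ξ) = i α·ξ - i (Q(ξ) + Q̃(ξ)) - (R(ξ) + R̃(ξ))`, valid on an open convex neighbourhood `U`
of `0` on which the principal logarithm in `Γ_{ξ₀}` is evaluated off its branch cut. Here `Q`, `R`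
are real polynomials without constant and linear terms, and `Q̃`, `R̃` (`Qt`, `Rt`) are real-valued,
smooth on `U`, and vanish at `0`. -/
structure GammaExpansion {d : ℕ} (φ : IntLattice d → ℂ) (ξ₀ : Space d) where
  U : Set (Space d)
  isOpen_U : IsOpen U
  convex_U : Convex ℝ U
  zero_mem_U : (0 : Space d) ∈ U
  mem_slitPlane : ∀ ξ ∈ U, fourierSeries φ (ξ + ξ₀) / fourierSeries φ ξ₀ ∈ Complex.slitPlane
  α : Space d
  Q : MvPolynomial (Fin d) ℝ
  R : MvPolynomial (Fin d) ℝ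
  Q_coeff : ∀ m : Fin d →₀ ℕ, m.degree ≤ 1 → Q.coeff m = 0
  R_coeff : ∀ m : Fin d →₀ ℕ, m.degree ≤ 1 → R.coeff m = 0
  Qt : Space d → ℝ
  Rt : Space d → ℝ
  smooth_Qt : ContDiffOn ℝ ∞ Qt U
  smooth_Rt : ContDiffOn ℝ ∞ Rt U
  Qt_zero : Qt 0 = 0
  Rt_zero : Rt 0 = 0
  expansion : ∀ ξ ∈ U, Gam φ ξ₀ ξ =
    Complex.I * (inner ℝ α ξ : ℝ) - Complex.I * ((polyFun Q ξ + Qt ξ : ℝ) : ℂ)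
      - ((polyFun R ξ + Rt ξ : ℝ) : ℂ)

/-- The expansion exhibits `ξ₀` as a point of positive homogeneous type for `φ̂`. Its homogeneous
order is then `μ_R`, and its drift is `α`. -/
def GammaExpansion.IsPositiveType {d : ℕ} {φ : IntLattice d → ℂ} {ξ₀ : Space d}
    (e : GammaExpansion φ ξ₀) : Prop :=
  IsPositiveHomogeneous (polyFun e.R) ∧
    ∃ E ∈ exponentSet (polyFun e.R), E ∈ exponentSet (polyFun e.Q) ∧
      IsSubhomogeneous e.U e.Rt E ∧ IsSubhomogeneous e.U e.Qt E

/-- The expansion exhibits `ξ₀` as a point of imaginary homogeneous type for `φ̂`. Its homogeneous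
order is then `μ_{|Q|}`, and its drift is `α`. -/
def GammaExpansion.IsImaginaryType {d : ℕ} {φ : IntLattice d → ℂ} {ξ₀ : Space d}
    (e : GammaExpansion φ ξ₀) : Prop :=
  IsPositiveHomogeneous (fun ξ => |polyFun e.Q ξ|) ∧ IsPositiveHomogeneous (polyFun e.R) ∧
    ∃ E ∈ exponentSet (fun ξ => |polyFun e.Q ξ|), ∃ k : ℝ, 1 < k ∧
      k⁻¹ • E ∈ exponentSet (polyFun e.R) ∧
      IsStronglySubhomogeneous e.U e.Qt E 2 ∧
      IsStronglySubhomogeneous e.U e.Rt (k⁻¹ • E) 1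

/-! ### Attractors -/

/-- The function `ξ ↦ e^{-t P(ξ)} e^{-i x·ξ}`. -/
def attractorIntegrand {d : ℕ} (P : Space d → ℂ) (t : ℝ) (x ξ : Space d) : ℂ :=
  Complex.exp (-((t : ℂ) * P ξ)) * Complex.exp (-(Complex.I * (inner ℝ x ξ : ℝ)))

/-- The attractor `H_P^t(x) = (2π)^{-d} ∫ e^{-t P(ξ)} e^{-i x·ξ} dξ`, a Lebesgue integral. -/
def attractor {d : ℕ} (P : Space d → ℂ) (t : ℝ) (x : Space d) : ℂ :=
  (1 / (2 * (Real.pi : ℂ)) ^ d) * ∫ ξ, attractorIntegrand P t x ξ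

/-- The renormalized integral of `f` associated to the approximating family `O` converges
to `L`. -/
def HasRenormIntegral {d : ℕ} (O : ℝ → Set (Space d)) (f : Space d → ℂ) (L : ℂ) : Prop :=
  Filter.Tendsto (fun τ : ℝ => ∫ ξ in O τ, f ξ) Filter.atTop (nhds L)

/-- The value of the renormalized integral (meaningful where it converges). -/
def renormIntegral {d : ℕ} (O : ℝ → Set (Space d)) (f : Space d → ℂ) : ℂ :=
  Filter.limUnder Filter.atTop fun τ : ℝ => ∫ ξ in O τ, f ξ

/-- The approximating family `O_τ = {ξ : |Q(ξ)| < τ}` of `ℝ^d`. -/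
def sublevel {d : ℕ} (Q : Space d → ℝ) (τ : ℝ) : Set (Space d) :=
  {ξ | |Q ξ| < τ}

/-- The oscillatory attractor `H_{iQ}^t(x)`, which is `(2π)^{-d}` times the renormalized integral
of `e^{-i t Q(ξ)} e^{-i x·ξ}` associated to the family `{|Q| < τ}`, `τ > 0`. -/
def oscAttractor {d : ℕ} (Q : Space d → ℝ) (t : ℝ) (x : Space d) : ℂ :=
  (1 / (2 * (Real.pi : ℂ)) ^ d) *
    renormIntegral (sublevel Q) (attractorIntegrand (fun ξ => Complex.I * (Q ξ : ℂ)) t x)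

/-- The complex polynomial `P = R + i Q` attached to an expansion. -/
def GammaExpansion.P {d : ℕ} {φ : IntLattice d → ℂ} {ξ₀ : Space d}
    (e : GammaExpansion φ ξ₀) (ξ : Space d) : ℂ :=
  (polyFun e.R ξ : ℂ) + Complex.I * (polyFun e.Q ξ : ℂ)

end LocalLimit

end

open LocalLimit

open scoped ContDiff

noncomputable section

namespace LocalLimit

open MeasureTheory Filter Topology

variable {d : ℕ}

/-! ### The determinant of a one-parameter group -/

/-! Fourier inversion over the cube centred at `ξ₀` writes `(2π)^d φ^(n)(x)` as the integral of the
n-th power of the transform against a character. The modulus is 1 only at the centre, so a fixed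
neighbourhood `{P < δ}` carries everything up to an exponentially small error
(`convPow_localization`), where `P` is `R` or `|Q|`. On it the expansion applies, and the
substitution `ξ = n^{-E} η`, whose Jacobian is a power of `n` because `det t^E = t^{tr E}`
(`det_tpow`), produces the factor `n^{-μ}` and an integral over `{P < nδ}` depending on `x` only
through `y = n^{-E*}(x - nα)`. The attractor obeys the same scaling, so it suffices to compare
rescaled integrals with the attractor at time 1 and point `y`, uniformly in `y`
(`local_limit_of_scaled`).

In the positive case the rescaled integrand converges in `L¹`, dominated by a multiple of
`exp(-R/2)`. The character has modulus 1, so the estimate is uniform in all `x` (`tendsto_L1`).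

In the imaginary case nothing is absolutely integrable in the limit. The integrals are cut at `{|Q|
< a}`. Inside, dominated convergence applies for fixed `a`, and the real part disappears because `n
R(n^{-E} η) = n^{1-k} R(η)` with `k > 1` (`tendsto_scaled_imaginary`). Outside, both the rescaled
integrals and the attractor have tails `O(a^{μ-1})`, uniformly in `n` and in bounded `y`
(`exists_tail_bound`), which is small as `μ < 1`.

The tail bound is a single integration by parts along the orbits `s ↦ s^E w`
(`norm_integral_oscillatory_le`), where the density is `s^{μ-1}` and the main phase is `s Q(w)`. The
linear phase `y · s^E w` is harmless: `Q` vanishes to second order at 0, so `‖s^E‖ = O(√s)`. Strong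
subhomogeneity controls two derivatives of the remaining phase and one of the amplitude. Polar
coordinates need no surface measure: the level set is thickened to a shell and averaged against
`ds/s` (`log_two_smul_integral_eq`). -/

theorem differentiable_det :
    Differentiable ℝ fun A : Space d →L[ℝ] Space d =>
      LinearMap.det (A : Space d →ₗ[ℝ] Space d) := by
  let b := EuclideanSpace.basisFun (Fin d) ℝ
  -- The Leibniz expansion exhibits the determinant as a polynomial in matrix entries, each linear
  -- in `A`.
  have h : (fun A : Space d →L[ℝ] Space d => LinearMap.det (A : Space d →ₗ[ℝ] Space d)) =
      fun A => ∑ σ : Equiv.Perm (Fin d), ((Equiv.Perm.sign σ : ℤ) : ℝ) *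
        ∏ i, inner ℝ (b (σ i)) (A (b i)) := by
    funext A
    rw [← LinearMap.det_toMatrix b.toBasis, Matrix.det_apply']
    simp [LinearMap.toMatrix_apply, b, EuclideanSpace.inner_single_left]
  rw [h]
  refine Differentiable.fun_sum fun σ _ => Differentiable.const_mul ?_ _
  have : ∀ i, Differentiable ℝ fun A : Space d →L[ℝ] Space d => inner ℝ (b (σ i)) (A (b i)) :=
    fun i => (differentiable_const _).inner ℝ
      (ContinuousLinearMap.apply ℝ (Space d) (b i)).differentiable
  exact fun A => (HasFDerivAt.finsetProd fun i _ => (this i A).hasFDerivAt).differentiableAt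

/-- Along the line `1 + rM` the determinant is `1 + r tr M` plus `r²` times a polynomial in `r`, so
its derivative at `r = 0` is the trace. -/
theorem fderiv_det_one (M : Space d →L[ℝ] Space d) :
    fderiv ℝ (fun A : Space d →L[ℝ] Space d => LinearMap.det (A : Space d →ₗ[ℝ] Space d)) 1 M =
      LinearMap.trace ℝ (Space d) (M : Space d →ₗ[ℝ] Space d) := by
  let b := EuclideanSpace.basisFun (Fin d) ℝ
  have h1 : HasDerivAt (fun r : ℝ => (1 : Space d →L[ℝ] Space d) + r • M) M 0 := by
    simpa using ((hasDerivAt_id (0 : ℝ)).smul_const M).const_add 1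
  have h2 := (differentiable_det (d := d)
    ((1 : Space d →L[ℝ] Space d) + (0 : ℝ) • M)).hasFDerivAt.comp_hasDerivAt (0 : ℝ) h1
  rw [zero_smul ℝ M, add_zero] at h2
  refine h2.unique ?_
  set B := LinearMap.toMatrix b.toBasis b.toBasis (M : Space d →ₗ[ℝ] Space d) with hB
  have h3 : ((fun A : Space d →L[ℝ] Space d => LinearMap.det (A : Space d →ₗ[ℝ] Space d)) ∘
      fun r : ℝ => (1 : Space d →L[ℝ] Space d) + r • M) = fun r : ℝ => 1 + B.trace * r +
        (Matrix.det (1 + (Polynomial.X : Polynomial ℝ) • B.map Polynomial.C)).divX.divX.eval r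
          * r ^ 2 := by
    funext r
    rw [← Matrix.det_one_add_smul, Function.comp_apply, ← LinearMap.det_toMatrix b.toBasis]
    congr 1
    rw [ContinuousLinearMap.toLinearMap_add, map_add, ContinuousLinearMap.toLinearMap_smul,
      map_smul]
    congr 1
    exact LinearMap.toMatrix_one _
  rw [h3, LinearMap.trace_eq_matrix_trace ℝ b.toBasis, ← hB]
  have h4 := (((hasDerivAt_id (0 : ℝ)).const_mul B.trace).const_add 1).add
    (((Matrix.det (1 + (Polynomial.X : Polynomial ℝ) • B.map Polynomial.C)).divX.divX.hasDerivAt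
      0).mul (hasDerivAt_pow 2 (0 : ℝ)))
  exact h4.congr_deriv (by simp)

/-! ### Calculus of `t ^ E` -/

theorem tpow_mul {s t : ℝ} (hs : 0 < s) (ht : 0 < t) (E : Space d →L[ℝ] Space d) :
    tpow (s * t) E = tpow s E * tpow t E := by
  let _ : NormedAlgebra ℚ (Space d →L[ℝ] Space d) := NormedAlgebra.restrictScalars ℚ ℝ _
  rw [tpow, Real.log_mul hs.ne' ht.ne', add_smul _ _ E, NormedSpace.exp_add_of_commute]
  · rfl
  · exact ContinuousLinearMap.ext fun x => by simp [smul_comm (Real.log s)]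

theorem tpow_mul_apply {s t : ℝ} (hs : 0 < s) (ht : 0 < t) (E : Space d →L[ℝ] Space d)
    (ξ : Space d) : tpow (s * t) E ξ = tpow s E (tpow t E ξ) := by
  rw [tpow_mul hs ht]; rfl

@[simp] theorem tpow_one (E : Space d →L[ℝ] Space d) : tpow 1 E = 1 := by
  rw [tpow, Real.log_one, zero_smul ℝ E, NormedSpace.exp_zero]

theorem tpow_inv_tpow {t : ℝ} (ht : 0 < t) (E : Space d →L[ℝ] Space d) (ξ : Space d) :
    tpow t⁻¹ E (tpow t E ξ) = ξ := by
  rw [← tpow_mul_apply (inv_pos.2 ht) ht, inv_mul_cancel₀ ht.ne', tpow_one]; rfl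

theorem tpow_tpow_inv {t : ℝ} (ht : 0 < t) (E : Space d →L[ℝ] Space d) (ξ : Space d) :
    tpow t E (tpow t⁻¹ E ξ) = ξ := by
  rw [← tpow_mul_apply ht (inv_pos.2 ht), mul_inv_cancel₀ ht.ne', tpow_one]; rfl

theorem hasDerivAt_tpow {t : ℝ} (ht : 0 < t) (E : Space d →L[ℝ] Space d) :
    HasDerivAt (fun s => tpow s E) (t⁻¹ • (E * tpow t E)) t := by
  have := (hasDerivAt_exp_smul_const' (𝕂 := ℝ) E (Real.log t)).scomp t (Real.hasDerivAt_log ht.ne')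
  exact this

theorem hasDerivAt_tpow_apply {t : ℝ} (ht : 0 < t) (E : Space d →L[ℝ] Space d) (ξ : Space d) :
    HasDerivAt (fun s => tpow s E ξ) (t⁻¹ • E (tpow t E ξ)) t :=
  (hasDerivAt_tpow ht E).clm_apply (hasDerivAt_const t ξ) |>.congr_deriv (by simp)

theorem continuousOn_tpow (E : Space d →L[ℝ] Space d) :
    ContinuousOn (fun s => tpow s E) (Set.Ioi 0) := fun _ ht =>
  (hasDerivAt_tpow ht E).continuousAt.continuousWithinAt

/-- The function `t ↦ det t^E` is multiplicative on `(0, ∞)` with derivative `tr E` at 1. These two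
facts give its derivative everywhere, and its product with `t^{-tr E}` is then constant. -/
theorem det_tpow {t : ℝ} (ht : 0 < t) (E : Space d →L[ℝ] Space d) :
    LinearMap.det (tpow t E : Space d →ₗ[ℝ] Space d) =
      t ^ LinearMap.trace ℝ (Space d) (E : Space d →ₗ[ℝ] Space d) := by
  set μ := LinearMap.trace ℝ (Space d) (E : Space d →ₗ[ℝ] Space d)
  let g : ℝ → ℝ := fun t => LinearMap.det (tpow t E : Space d →ₗ[ℝ] Space d)
  have hmul : ∀ s t, 0 < s → 0 < t → g (s * t) = g s * g t := fun s t hs ht => by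
    simp only [g, tpow_mul hs ht]
    exact LinearMap.det_comp _ _
  have h1 : HasDerivAt g μ 1 := by
    have h0 := (differentiable_det (d := d) (tpow 1 E)).hasFDerivAt.comp_hasDerivAt
      (1 : ℝ) (hasDerivAt_tpow one_pos E)
    rw [tpow_one] at h0
    exact h0.congr_deriv (by rw [inv_one, one_smul ℝ (E * 1), mul_one, fderiv_det_one])
  have hg : ∀ s, 0 < s → HasDerivAt g (g s * μ * s⁻¹) s := fun s hs => by
    have h2 : HasDerivAt (fun u => g (u / s)) (μ * s⁻¹) s := by
      have : HasDerivAt g μ (s / s) := by rwa [div_self hs.ne']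
      exact (HasDerivAt.comp (h := fun u => u / s) s this
        ((hasDerivAt_id s).div_const s)).congr_deriv (by rw [one_div])
    refine ((h2.const_mul (g s)).congr_of_eventuallyEq ?_).congr_deriv (by ring)
    filter_upwards [lt_mem_nhds hs] with u hu
    rw [← hmul _ _ hs (div_pos hu hs), mul_div_cancel₀ _ hs.ne']
  have h3 : ∀ s ∈ Set.Ioi (0 : ℝ), HasDerivAt (fun u => g u * u ^ (-μ)) 0 s := fun s hs => by
    refine ((hg s hs).mul (Real.hasDerivAt_rpow_const (p := -μ) (Or.inl (ne_of_gt hs)))).congr_deriv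
      ?_
    rw [Real.rpow_sub_one (ne_of_gt hs)]
    ring
  have h4 : g t * t ^ (-μ) = g 1 * 1 ^ (-μ) :=
    isOpen_Ioi.is_const_of_deriv_eq_zero isPreconnected_Ioi
      (fun s hs => (h3 s hs).differentiableAt.differentiableWithinAt) (fun s hs => (h3 s hs).deriv)
      ht (Set.mem_Ioi.2 one_pos)
  have h5 : g 1 = 1 := by simp only [g, tpow_one]; exact LinearMap.det_id
  rw [h5, Real.one_rpow, mul_one, Real.rpow_neg ht.le,
    mul_inv_eq_one₀ (Real.rpow_pos_of_pos ht _).ne'] at h4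
  exact h4

theorem det_tpow_ne_zero {t : ℝ} (ht : 0 < t) (E : Space d →L[ℝ] Space d) :
    LinearMap.det (tpow t E : Space d →ₗ[ℝ] Space d) ≠ 0 := by
  rw [det_tpow ht]; exact (Real.rpow_pos_of_pos ht _).ne'

theorem tpow_smul {t : ℝ} (ht : 0 < t) (c : ℝ) (E : Space d →L[ℝ] Space d) :
    tpow t (c • E) = tpow (t ^ c) E := by
  rw [tpow, tpow, Real.log_rpow ht, smul_smul, mul_comm]

theorem adjoint_tpow (t : ℝ) (E : Space d →L[ℝ] Space d) :
    ContinuousLinearMap.adjoint (tpow t E) = tpow t (ContinuousLinearMap.adjoint E) := by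
  rw [tpow, tpow, ← ContinuousLinearMap.star_eq_adjoint, ← ContinuousLinearMap.star_eq_adjoint,
    NormedSpace.star_exp, star_smul]
  simp

theorem measurableEmbedding_tpow {t : ℝ} (ht : 0 < t) (E : Space d →L[ℝ] Space d) :
    MeasurableEmbedding (tpow t E) :=
  (Homeomorph.mk ⟨tpow t E, tpow t⁻¹ E, tpow_inv_tpow ht E, tpow_tpow_inv ht E⟩
    (tpow t E).continuous (tpow t⁻¹ E).continuous).measurableEmbedding

theorem map_tpow_volume {t : ℝ} (ht : 0 < t) (E : Space d →L[ℝ] Space d) :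
    (volume : Measure (Space d)).map (tpow t E) =
      ENNReal.ofReal ((t ^ LinearMap.trace ℝ (Space d) (E : Space d →ₗ[ℝ] Space d))⁻¹) •
        volume := by
  have := Measure.map_linearMap_addHaar_eq_smul_addHaar (volume : Measure (Space d))
    (det_tpow_ne_zero ht E)
  rw [det_tpow ht, abs_of_pos (inv_pos.2 (Real.rpow_pos_of_pos ht _))] at this
  exact this

theorem setIntegral_tpow {V : Type*} [NormedAddCommGroup V] [NormedSpace ℝ V] {t : ℝ} (ht : 0 < t)
    (E : Space d →L[ℝ] Space d) (s : Set (Space d)) (F : Space d → V) :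
    ∫ η in tpow t E ⁻¹' s, F (tpow t E η) =
      ((t ^ LinearMap.trace ℝ (Space d) (E : Space d →ₗ[ℝ] Space d))⁻¹ : ℝ) •
        ∫ ξ in s, F ξ := by
  rw [← (measurableEmbedding_tpow ht E).setIntegral_map, map_tpow_volume ht,
    Measure.restrict_smul, integral_smul_measure, ENNReal.toReal_ofReal]
  exact (inv_pos.2 (Real.rpow_pos_of_pos ht _)).le

theorem integral_tpow {V : Type*} [NormedAddCommGroup V] [NormedSpace ℝ V] {t : ℝ} (ht : 0 < t)
    (E : Space d →L[ℝ] Space d) (F : Space d → V) :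
    ∫ η, F (tpow t E η) =
      ((t ^ LinearMap.trace ℝ (Space d) (E : Space d →ₗ[ℝ] Space d))⁻¹ : ℝ) • ∫ ξ, F ξ := by
  simpa using setIntegral_tpow ht E Set.univ F

theorem integrable_comp_tpow {V : Type*} [NormedAddCommGroup V] {t : ℝ} (ht : 0 < t)
    (E : Space d →L[ℝ] Space d) {F : Space d → V} (hF : Integrable F) :
    Integrable fun η => F (tpow t E η) := by
  refine (measurableEmbedding_tpow ht E).integrable_map_iff.1 ?_
  rw [map_tpow_volume ht]
  exact hF.smul_measure ENNReal.ofReal_ne_top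

theorem volume_preimage_tpow {t : ℝ} (ht : 0 < t) (E : Space d →L[ℝ] Space d) (s : Set (Space d)) :
    volume (tpow t E ⁻¹' s) =
      ENNReal.ofReal ((t ^ LinearMap.trace ℝ (Space d) (E : Space d →ₗ[ℝ] Space d))⁻¹) *
        volume s := by
  rw [← (measurableEmbedding_tpow ht E).map_apply, map_tpow_volume ht]; rfl

theorem norm_tpow_le {t : ℝ} (ht : 1 ≤ t) (E : Space d →L[ℝ] Space d) :
    ‖tpow t E‖ ≤ t ^ ‖E‖ := by
  -- The power 0 is treated apart, using only `‖1‖ ≤ 1`: the identity has norm 0 when `d = 0`.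
  have hpow : ∀ (x : Space d →L[ℝ] Space d) (n : ℕ), ‖x ^ n‖ ≤ ‖x‖ ^ n := fun x n => by
    induction n with
    | zero => simpa using! ContinuousLinearMap.norm_id_le (𝕜 := ℝ) (E := Space d)
    | succ n ih =>
      rw [pow_succ, pow_succ]
      exact (norm_mul_le _ _).trans (by gcongr)
  have hexp : ∀ x : Space d →L[ℝ] Space d, ‖NormedSpace.exp x‖ ≤ Real.exp ‖x‖ := fun x => by
    rw [NormedSpace.exp_eq_tsum ℝ, Real.exp_eq_exp_ℝ, NormedSpace.exp_eq_tsum ℝ]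
    refine tsum_of_norm_bounded (NormedSpace.expSeries_summable' (𝕂 := ℝ) ‖x‖).hasSum fun n => ?_
    rw [norm_smul, smul_eq_mul, Real.norm_of_nonneg (by positivity)]
    gcongr
    exact hpow x n
  refine (hexp _).trans (le_of_eq ?_)
  rw [norm_smul, Real.norm_of_nonneg (Real.log_nonneg ht), Real.rpow_def_of_pos (by linarith)]

/-! ### Positive homogeneous functions -/

/-- The trace of an endomorphism of `ℝ^d`. -/
def trE (E : Space d →L[ℝ] Space d) : ℝ :=
  LinearMap.trace ℝ (Space d) (E : Space d →ₗ[ℝ] Space d)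

theorem preimage_tpow_sublevel {P : Space d → ℝ} {E : Space d →L[ℝ] Space d}
    (hE : E ∈ exponentSet P) {t : ℝ} (ht : 0 < t) (r : ℝ) :
    tpow t E ⁻¹' {ξ | P ξ < r} = {ξ | P ξ < r / t} := by
  ext ξ
  simp only [Set.mem_preimage, Set.mem_ofPred_eq, hE t ht ξ]
  rw [lt_div_iff₀ ht, mul_comm]

/-- Contraction bounds the norm near 0, and continuity on a compact interval bounds it on the rest
of `(0, 1]`. -/
theorem IsContracting.exists_norm_tpow_le {E : Space d →L[ℝ] Space d} (hc : IsContracting E) :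
    ∃ C : ℝ, 1 ≤ C ∧ ∀ t, 0 < t → t ≤ 1 → ‖tpow t E‖ ≤ C := by
  have h := hc.eventually (Iio_mem_nhds (zero_lt_one (α := ℝ)))
  obtain ⟨u, hu, hu'⟩ := mem_nhdsGT_iff_exists_Ioo_subset.1 h
  have hu : 0 < u := hu
  have hcont : ContinuousOn (fun t => ‖tpow t E‖) (Set.Icc (u / 2) 1) :=
    ((continuousOn_tpow E).mono fun t ht => (half_pos hu).trans_le ht.1).norm
  obtain ⟨B, hB⟩ := isCompact_Icc.bddAbove_image hcont
  refine ⟨max 1 B, le_max_left _ _, fun t ht ht1 => ?_⟩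
  rcases lt_or_ge t u with h1 | h1
  · exact (le_of_lt (hu' ⟨ht, h1⟩)).trans (le_max_left _ _)
  · exact (hB ⟨t, ⟨by linarith, ht1⟩, rfl⟩).trans (le_max_right _ _)

theorem exists_polar {P : Space d → ℝ} {E : Space d →L[ℝ] Space d} (hE : E ∈ exponentSet P)
    {ξ : Space d} (h : 0 < P ξ) : ∃ w, P w = 1 ∧ ξ = tpow (P ξ) E w :=
  ⟨tpow (P ξ)⁻¹ E ξ, by rw [hE _ (inv_pos.2 h), inv_mul_cancel₀ h.ne'],
    (tpow_tpow_inv h E ξ).symm⟩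

namespace IsPositiveHomogeneous

variable {P : Space d → ℝ} (hP : IsPositiveHomogeneous P)

include hP

theorem map_zero : P 0 = 0 := by
  obtain ⟨E, hE⟩ := hP.exponentSet_nonempty
  have := hE 2 two_pos 0
  rw [_root_.map_zero] at this
  linarith

theorem pos {ξ : Space d} (h : ξ ≠ 0) : 0 < P ξ :=
  lt_of_le_of_ne (hP.nonneg ξ) fun h' => h (hP.eq_zero ξ h'.symm)

variable {E : Space d →L[ℝ] Space d} (hE : E ∈ exponentSet P)

include hE

/-- In polar form `ξ = P(ξ)^E w` the point `w` lies in the compact level set, and `‖t^E‖` is bounded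
for `t ≤ 1` and at most `t^‖E‖` for `t ≥ 1`. This growth bound yields both the compactness of
sublevel sets and the integrability of `exp(-tP)`. -/
theorem exists_norm_le (hc : IsContracting E) :
    ∃ C : ℝ, 0 < C ∧ ∀ ξ, ‖ξ‖ ≤ C * (1 + P ξ) ^ ‖E‖ := by
  obtain ⟨C, hC1, hC⟩ := hc.exists_norm_tpow_le
  obtain ⟨ρ, hρ, hρ'⟩ := hP.isCompact_level.isBounded.exists_pos_norm_le
  refine ⟨C * ρ, by positivity, fun ξ => ?_⟩
  have h0 := hP.nonneg ξ
  have hone : 1 ≤ (1 + P ξ) ^ ‖E‖ := Real.one_le_rpow (by linarith) (norm_nonneg _)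
  rcases eq_or_ne ξ 0 with rfl | hξ
  · rw [norm_zero]; positivity
  obtain ⟨w, hw, hξw⟩ := exists_polar hE (hP.pos hξ)
  have h1 : ‖ξ‖ ≤ ‖tpow (P ξ) E‖ * ρ := by
    conv_lhs => rw [hξw]
    exact ((tpow (P ξ) E).le_opNorm w).trans (by gcongr; exact hρ' w hw)
  refine h1.trans ?_
  have h2 : ‖tpow (P ξ) E‖ ≤ C * (1 + P ξ) ^ ‖E‖ := by
    rcases le_total (P ξ) 1 with h | h
    · exact (hC _ (hP.pos hξ) h).trans (le_mul_of_one_le_right (by linarith) hone)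
    · calc ‖tpow (P ξ) E‖ ≤ P ξ ^ ‖E‖ := norm_tpow_le h E
        _ ≤ (1 + P ξ) ^ ‖E‖ := by gcongr; linarith
        _ ≤ _ := le_mul_of_one_le_left (by positivity) hC1
  calc _ ≤ C * (1 + P ξ) ^ ‖E‖ * ρ := by gcongr
    _ = _ := by ring

theorem isCompact_le (hc : IsContracting E) (r : ℝ) : IsCompact {ξ | P ξ ≤ r} := by
  obtain ⟨C, hC, h⟩ := hP.exists_norm_le hE hc
  refine Metric.isCompact_of_isClosed_isBounded (isClosed_le hP.continuous continuous_const) ?_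
  refine isBounded_iff_forall_norm_le.2 ⟨C * (1 + r) ^ ‖E‖, fun ξ hξ => (h ξ).trans ?_⟩
  have := hP.nonneg ξ
  gcongr
  exact hξ

/-- By definiteness, `P` has a positive minimum on the compact set `{P ≤ 1, ‖ξ‖ ≥ r}`. Sublevel sets
can thus serve as small neighbourhoods of the origin. -/
theorem exists_norm_lt (hc : IsContracting E) {r : ℝ} (hr : 0 < r) :
    ∃ δ : ℝ, 0 < δ ∧ ∀ ξ, P ξ < δ → ‖ξ‖ < r := by
  have hK : IsCompact ({ξ | P ξ ≤ 1} ∩ {ξ | r ≤ ‖ξ‖}) :=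
    (hP.isCompact_le hE hc 1).inter_right (isClosed_le continuous_const continuous_norm)
  rcases Set.eq_empty_or_nonempty ({ξ | P ξ ≤ 1} ∩ {ξ : Space d | r ≤ ‖ξ‖}) with h | h
  · refine ⟨1, one_pos, fun ξ hξ => ?_⟩
    by_contra hn
    exact Set.notMem_empty ξ (h ▸ ⟨hξ.le, not_lt.1 hn⟩)
  · obtain ⟨x, hx, hmin⟩ := hK.exists_isMinOn h hP.continuous.continuousOn
    have hx0 : 0 < P x := hP.pos (norm_pos_iff.1 (hr.trans_le hx.2))
    refine ⟨P x, hx0, fun ξ hξ => ?_⟩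
    by_contra hn
    exact absurd hξ (not_lt.2 (hmin ⟨(hξ.trans_le hx.1).le, not_lt.1 hn⟩))

/-- The order is defined through an arbitrarily chosen exponent. Every exponent `F` gives `vol {P <
1/2} = 2^{-tr F} vol {P < 1}` with a positive finite volume on the right, so `P` determines the
trace. -/
theorem homOrder_eq (hc : IsContracting E) : homOrder P = trE E := by
  have hne := hP.exponentSet_nonempty
  rw [homOrder, dif_pos hne]
  have hfin : volume {ξ | P ξ < 1} ≠ ⊤ :=
    ((measure_mono fun ξ (h : P ξ < 1) => h.le).trans_lt
      (hP.isCompact_le hE hc 1).measure_lt_top).ne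
  have hpos : volume {ξ | P ξ < 1} ≠ 0 :=
    ((isOpen_lt hP.continuous continuous_const).measure_pos _ ⟨0, by simp [hP.map_zero]⟩).ne'
  have key : ∀ F ∈ exponentSet P, volume {ξ | P ξ < 1 / 2} =
      ENNReal.ofReal ((2 ^ trE F)⁻¹) * volume {ξ | P ξ < 1} := fun F hF => by
    rw [← preimage_tpow_sublevel hF two_pos 1]
    exact volume_preimage_tpow two_pos F _
  have h1 := (key _ hne.choose_spec).symm.trans (key E hE)
  rw [ENNReal.mul_left_inj hpos hfin, ENNReal.ofReal_eq_ofReal_iff (by positivity) (by positivity),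
    inv_inj] at h1
  exact (Real.rpow_right_inj two_pos (by norm_num)).1 h1

theorem integrable_exp_neg (hc : IsContracting E) {t : ℝ} (ht : 0 < t) :
    Integrable fun ξ => Real.exp (-(t * P ξ)) := by
  obtain ⟨C, hC, h⟩ := hP.exists_norm_le hE hc
  -- Any exponent above `d` makes `(1 + ‖ξ‖)^{-m}` integrable; `exp(-tP)` beats the power of `1 + P`
  -- that controls `(1 + ‖ξ‖)^m`.
  set m : ℝ := d + 1
  set M := ‖E‖ * m
  -- polynomial decay
  obtain ⟨B, hB0, hB⟩ : ∃ B : ℝ, 0 < B ∧ ∀ s : ℝ, 0 ≤ s →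
      (1 + s) ^ M * Real.exp (-(t * s)) ≤ B := by
    have hlim := tendsto_rpow_mul_exp_neg_mul_atTop_nhds_zero M t ht
    have hlim2 : Tendsto (fun s : ℝ => (1 + s) ^ M * Real.exp (-(t * s))) atTop (𝓝 0) := by
      have := (hlim.comp (tendsto_atTop_add_const_left _ 1 tendsto_id)).mul_const (Real.exp t)
      rw [zero_mul] at this
      refine this.congr fun s => ?_
      simp only [Function.comp_apply, id]
      rw [mul_assoc, ← Real.exp_add]
      congr 2; ring
    obtain ⟨S, hS⟩ :=
      (hlim2.eventually (Iio_mem_nhds (zero_lt_one (α := ℝ)))).exists_forall_of_atTop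
    have hcont : ContinuousOn (fun s : ℝ => (1 + s) ^ M * Real.exp (-(t * s))) (Set.Icc 0 S) := by
      refine ContinuousOn.mul (ContinuousOn.rpow_const (by fun_prop) fun s hs => Or.inl ?_)
        (by fun_prop)
      have := hs.1; positivity
    obtain ⟨B, hB⟩ := isCompact_Icc.bddAbove_image hcont
    refine ⟨max 1 B, by positivity, fun s hs => ?_⟩
    rcases le_total S s with h1 | h1
    · exact (le_of_lt (hS s h1)).trans (le_max_left _ _)
    · exact (hB ⟨s, ⟨hs, h1⟩, rfl⟩).trans (le_max_right _ _)
  have hint := integrable_one_add_norm (E := Space d) (μ := volume) (r := m) (by simp [m])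
  refine (hint.const_mul ((1 + C) ^ m * B)).mono'
    (by have := hP.continuous; exact (by fun_prop : Continuous _).aestronglyMeasurable)
    (Eventually.of_forall fun ξ => ?_)
  rw [Real.norm_of_nonneg (Real.exp_pos _).le]
  have h0 := hP.nonneg ξ
  have hm : 0 ≤ m := by positivity
  have hone : 1 ≤ (1 + P ξ) ^ ‖E‖ := Real.one_le_rpow (by linarith) (norm_nonneg _)
  have h1 : (1 + ‖ξ‖) ^ m ≤ (1 + C) ^ m * (1 + P ξ) ^ M := by
    rw [Real.rpow_mul (by linarith), ← Real.mul_rpow (by linarith) (by linarith)]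
    refine Real.rpow_le_rpow (by positivity) ?_ hm
    nlinarith [h ξ]
  rw [Real.rpow_neg (by positivity), ← div_eq_mul_inv, le_div_iff₀ (by positivity)]
  calc Real.exp (-(t * P ξ)) * (1 + ‖ξ‖) ^ m
      ≤ Real.exp (-(t * P ξ)) * ((1 + C) ^ m * (1 + P ξ) ^ M) := by gcongr
    _ = (1 + C) ^ m * ((1 + P ξ) ^ M * Real.exp (-(t * P ξ))) := by ring
    _ ≤ (1 + C) ^ m * B := by gcongr; exact hB _ h0

end IsPositiveHomogeneous

/-! ### Fourier series on `ℤ^d` -/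

/-- The character `ξ ↦ e^{i x·ξ}`. -/
def chr (x ξ : Space d) : ℂ := Complex.exp (Complex.I * (inner ℝ x ξ : ℝ))

theorem norm_chr (x ξ : Space d) : ‖chr x ξ‖ = 1 := by
  rw [chr, mul_comm, Complex.norm_exp_ofReal_mul_I]

theorem chr_add_left (x y ξ : Space d) : chr (x + y) ξ = chr x ξ * chr y ξ := by
  rw [chr, chr, chr, ← Complex.exp_add, inner_add_left]
  push_cast; ring_nf

theorem chr_add_right (x ξ η : Space d) : chr x (ξ + η) = chr x ξ * chr x η := by
  rw [chr, chr, chr, ← Complex.exp_add, inner_add_right]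
  push_cast; ring_nf

theorem chr_neg_left (x ξ : Space d) :
    chr (-x) ξ = Complex.exp (-(Complex.I * (inner ℝ x ξ : ℝ))) := by
  rw [chr, inner_neg_left]; push_cast; ring_nf

theorem continuous_chr (x : Space d) : Continuous (chr x) := by
  unfold chr; fun_prop

theorem latticePoint_add (x y : IntLattice d) :
    latticePoint (x + y) = latticePoint x + latticePoint y := by
  ext i; simp [latticePoint]

theorem latticePoint_sub (x y : IntLattice d) :
    latticePoint (x - y) = latticePoint x - latticePoint y := by
  ext i; simp [latticePoint]

theorem fourierSeries_eq (φ : IntLattice d → ℂ) (ξ : Space d) :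
    fourierSeries φ ξ = ∑' x, φ x * chr (latticePoint x) ξ := rfl

theorem MemS.summable {φ : IntLattice d → ℂ} (h : MemS φ) : Summable fun x => ‖φ x‖ := by
  simpa using h 0

theorem summable_norm_mul_chr {φ : IntLattice d → ℂ} (h : Summable fun x => ‖φ x‖) (ξ : Space d) :
    Summable fun x => ‖φ x * chr (latticePoint x) ξ‖ := by
  simpa [norm_chr] using h

theorem continuous_fourierSeries {φ : IntLattice d → ℂ} (h : Summable fun x => ‖φ x‖) :
    Continuous (fourierSeries φ) :=
  continuous_tsum (fun x => continuous_const.mul (continuous_chr (latticePoint x))) h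
    fun x ξ => by rw [norm_mul, ← chr, norm_chr, mul_one]

/-- The bijection `(x, y) ↦ (x - y, y)`. -/
def shearEquiv (G : Type*) [AddCommGroup G] : G × G ≃ G × G where
  toFun p := (p.1 - p.2, p.2)
  invFun p := (p.1 + p.2, p.2)
  left_inv p := by simp
  right_inv p := by simp

/-! ### Convolution becomes multiplication -/

section convolution

variable {f g : IntLattice d → ℂ} (hf : Summable fun x => ‖f x‖) (hg : Summable fun x => ‖g x‖)

include hf hg

theorem summable_norm_shear : Summable fun p : IntLattice d × IntLattice d =>
    ‖f (p.1 - p.2) * g p.2‖ := by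
  have := (shearEquiv (IntLattice d)).summable_iff.2 (hf.mul_norm hg)
  exact this

theorem summable_norm_convolution :
    Summable fun x => ‖∑' y, f (x - y) * g y‖ := by
  have h := summable_norm_shear hf hg
  refine Summable.of_nonneg_of_le (fun _ => norm_nonneg _) (fun x => ?_) h.prod
  exact norm_tsum_le_tsum_norm (h.prod_factor x)

theorem fourierSeries_convolution (ξ : Space d) :
    fourierSeries (fun x => ∑' y, f (x - y) * g y) ξ = fourierSeries f ξ * fourierSeries g ξ := by
  have hF := summable_norm_mul_chr hf ξ
  have hG := summable_norm_mul_chr hg ξ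
  have hs : Summable fun p : IntLattice d × IntLattice d =>
      (f (p.1 - p.2) * chr (latticePoint (p.1 - p.2)) ξ) * (g p.2 * chr (latticePoint p.2) ξ) := by
    have := (shearEquiv (IntLattice d)).summable_iff.2 (hF.mul_norm hG)
    exact Summable.of_norm this
  rw [fourierSeries_eq f, fourierSeries_eq g, tsum_mul_tsum_of_summable_norm hF hG,
    ← (shearEquiv (IntLattice d)).tsum_eq, fourierSeries_eq]
  simp only [shearEquiv, Equiv.coe_fn_mk]
  rw [hs.tsum_prod]
  refine tsum_congr fun x => ?_
  rw [← tsum_mul_right]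
  refine tsum_congr fun y => ?_
  have : chr (latticePoint x) ξ = chr (latticePoint (x - y)) ξ * chr (latticePoint y) ξ := by
    rw [← chr_add_left, ← latticePoint_add, sub_add_cancel]
  rw [this]; ring

end convolution

theorem summable_norm_convPow {φ : IntLattice d → ℂ} (h : Summable fun x => ‖φ x‖) (n : ℕ) :
    Summable fun x => ‖convPow φ (n + 1) x‖ := by
  induction n with
  | zero => exact h
  | succ n ih => exact summable_norm_convolution ih h

theorem fourierSeries_convPow {φ : IntLattice d → ℂ} (h : Summable fun x => ‖φ x‖) (n : ℕ)
    (ξ : Space d) : fourierSeries (convPow φ (n + 1)) ξ = fourierSeries φ ξ ^ (n + 1) := by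
  induction n with
  | zero => rw [zero_add, pow_one]; rfl
  | succ n ih =>
    rw [pow_succ, ← ih]
    exact fourierSeries_convolution (summable_norm_convPow h n) h ξ

/-! ### Fourier inversion -/

/-- The closed cube `[-π, π]^d`. -/
def cube (d : ℕ) : Set (Space d) := {ξ | ∀ i, ξ i ∈ Set.Icc (-Real.pi) Real.pi}

theorem isCompact_cube : IsCompact (cube d) := by
  have h : IsCompact (Set.univ.pi fun _ : Fin d => Set.Icc (-Real.pi) Real.pi) :=
    isCompact_univ_pi fun _ => isCompact_Icc
  have := h.image (PiLp.continuous_toLp 2 fun _ : Fin d => ℝ)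
  convert! this using 1
  ext ξ
  constructor
  · exact fun hξ => ⟨fun i => ξ i, fun i _ => hξ i, rfl⟩
  · rintro ⟨v, hv, rfl⟩
    exact fun i => hv i trivial

theorem integral_exp_int_mul (m : ℤ) :
    ∫ s in Set.Icc (-Real.pi) Real.pi, Complex.exp (Complex.I * ((m * s : ℝ) : ℂ)) =
      if m = 0 then 2 * (Real.pi : ℂ) else 0 := by
  have hpi : -Real.pi ≤ Real.pi := by linarith [Real.pi_pos]
  rw [integral_Icc_eq_integral_Ioc, ← intervalIntegral.integral_of_le hpi]
  split_ifs with h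
  · simp [h]; ring
  · have hc : Complex.I * (m : ℂ) ≠ 0 := mul_ne_zero Complex.I_ne_zero (by exact_mod_cast h)
    have := integral_exp_mul_complex (a := -Real.pi) (b := Real.pi) hc
    have h2 : (fun s : ℝ => Complex.exp (Complex.I * ((m * s : ℝ) : ℂ))) =
        fun s : ℝ => Complex.exp (Complex.I * (m : ℂ) * s) := by
      funext s; push_cast; ring_nf
    rw [h2, this]
    have h3 : Complex.exp (Complex.I * m * (Real.pi : ℝ)) =
        Complex.exp (Complex.I * m * ((-Real.pi : ℝ) : ℂ)) := by
      rw [Complex.exp_eq_exp_iff_exists_int]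
      exact ⟨m, by push_cast; ring⟩
    rw [h3, sub_self, zero_div]

theorem setIntegral_cube_chr (x : IntLattice d) :
    ∫ ξ in cube d, chr (latticePoint x) ξ = if x = 0 then (2 * (Real.pi : ℂ)) ^ d else 0 := by
  have hmp := PiLp.volume_preserving_toLp (Fin d)
  have he : MeasurableEmbedding (WithLp.toLp 2 : (Fin d → ℝ) → Space d) :=
    (MeasurableEquiv.toLp 2 (Fin d → ℝ)).measurableEmbedding
  rw [← hmp.setIntegral_preimage_emb he]
  have hpre : (WithLp.toLp 2 : (Fin d → ℝ) → Space d) ⁻¹' cube d =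
      Set.univ.pi fun _ : Fin d => Set.Icc (-Real.pi) Real.pi := by
    ext v; simp only [cube, Set.mem_preimage, Set.mem_ofPred_eq, Set.mem_univ_pi]
  rw [hpre, volume_pi, Measure.restrict_pi_pi]
  have hprod : (fun v : Fin d → ℝ => chr (latticePoint x) (WithLp.toLp 2 v)) =
      fun v => ∏ i, Complex.exp (Complex.I * ((x i * v i : ℝ) : ℂ)) := by
    funext v
    rw [← Complex.exp_sum, chr, ← Finset.mul_sum, PiLp.inner_apply]
    push_cast
    simp [latticePoint, mul_comm]
  rw [hprod, integral_fintype_prod_eq_prod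
    (fun i s => Complex.exp (Complex.I * (((x i : ℝ) * s : ℝ) : ℂ)))]
  simp_rw [integral_exp_int_mul]
  split_ifs with h
  · simp [h]
  · obtain ⟨i, hi⟩ := Function.ne_iff.1 h
    exact Finset.prod_eq_zero (Finset.mem_univ i) (if_neg hi)

/-- Shifting the cube by `ξ₀` needs no periodicity argument: each term only acquires the constant
factor `e^{i(y - x)·ξ₀}`, which is 1 in the sole surviving term `y = x`. -/
theorem fourier_inversion {f : IntLattice d → ℂ} (hf : Summable fun x => ‖f x‖)
    (ξ₀ : Space d) (x : IntLattice d) :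
    ∫ ξ in cube d, fourierSeries f (ξ + ξ₀) * chr (-latticePoint x) (ξ + ξ₀) =
      (2 * (Real.pi : ℂ)) ^ d * f x := by
  have hterm : ∀ ξ : Space d, fourierSeries f (ξ + ξ₀) * chr (-latticePoint x) (ξ + ξ₀) =
      ∑' y, f y * chr (latticePoint (y - x)) (ξ + ξ₀) := fun ξ => by
    rw [fourierSeries_eq, ← tsum_mul_right]
    refine tsum_congr fun y => ?_
    rw [mul_assoc, ← chr_add_left, latticePoint_sub, sub_eq_add_neg]
  have hint : ∀ y, IntegrableOn (fun ξ => f y * chr (latticePoint (y - x)) (ξ + ξ₀)) (cube d) :=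
    fun y => (continuous_const.mul ((continuous_chr _).comp
      (continuous_id.add continuous_const))).continuousOn.integrableOn_compact isCompact_cube
  have hsum : Summable fun y => ∫ ξ in cube d, ‖f y * chr (latticePoint (y - x)) (ξ + ξ₀)‖ := by
    simp only [norm_mul, norm_chr, mul_one, integral_const]
    exact hf.mul_left _
  simp_rw [hterm]
  rw [← integral_tsum_of_summable_integral_norm hint hsum]
  have h1 : ∀ y, ∫ ξ in cube d, f y * chr (latticePoint (y - x)) (ξ + ξ₀) =
      if y = x then (2 * (Real.pi : ℂ)) ^ d * f x else 0 := fun y => by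
    simp_rw [chr_add_right, integral_const_mul, integral_mul_const, setIntegral_cube_chr,
      sub_eq_zero]
    split_ifs with h
    · have hz : chr (latticePoint (0 : IntLattice d)) ξ₀ = 1 := by
        rw [show latticePoint (0 : IntLattice d) = 0 by ext i; simp [latticePoint]]; simp [chr]
      rw [h, sub_self, hz]; ring
    · simp
  simp_rw [h1]
  exact tsum_ite_eq x _

/-! ### The maximum modulus on the cube -/

theorem fourierSeries_add_two_pi (φ : IntLattice d → ℂ) (ξ : Space d) (m : IntLattice d) :
    fourierSeries φ (ξ + (2 * Real.pi) • latticePoint m) = fourierSeries φ ξ := by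
  rw [fourierSeries_eq, fourierSeries_eq]
  refine tsum_congr fun x => ?_
  rw [chr_add_right]
  have : chr (latticePoint x) ((2 * Real.pi) • latticePoint m) = 1 := by
    rw [chr, Complex.exp_eq_one_iff]
    refine ⟨∑ i, m i * x i, ?_⟩
    rw [inner_smul_right, PiLp.inner_apply]
    simp only [latticePoint]
    push_cast
    simp only [RCLike.inner_apply, conj_trivial]
    push_cast
    ring
  rw [this, mul_one]

/-- A point of modulus 1 can be moved by `2πm` into the half-open torus, where it must be `ξ₀`.
Hence `ξ = -2πm`, and `|ξ_i| ≤ π` forces `m = 0`; this covers the closed cube with all its faces. -/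
theorem norm_fourierSeries_lt_one {φ : IntLattice d → ℂ}
    (hsup : IsLUB (Set.range fun ξ : Space d => ‖fourierSeries φ ξ‖) 1)
    {ξ₀ : Space d} (hΩ : Omega φ = {ξ₀}) {ξ : Space d} (hξ : ξ ∈ cube d) (h0 : ξ ≠ 0) :
    ‖fourierSeries φ (ξ + ξ₀)‖ < 1 := by
  refine lt_of_le_of_ne (hsup.1 ⟨_, rfl⟩) fun h1 => h0 ?_
  have hp : (0 : ℝ) < 2 * Real.pi := by positivity
  have hmem : ∀ i, ∃ k : ℤ, ξ i + ξ₀ i + 2 * Real.pi * k ∈ Set.Ioc (-Real.pi) Real.pi := fun i => by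
    obtain ⟨k, hk, -⟩ := existsUnique_add_zsmul_mem_Ioc hp (ξ i + ξ₀ i) (-Real.pi)
    refine ⟨k, ?_⟩
    rw [zsmul_eq_mul, show -Real.pi + 2 * Real.pi = Real.pi by ring] at hk
    rwa [mul_comm (2 * Real.pi)]
  choose m hm using hmem
  have h2 : ξ + ξ₀ + (2 * Real.pi) • latticePoint m ∈ Omega φ :=
    ⟨fun i => by simpa [latticePoint] using hm i, by rwa [fourierSeries_add_two_pi]⟩
  rw [hΩ, Set.mem_singleton_iff] at h2
  ext i
  have h3 := congrArg (fun v : Space d => v i) h2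
  simp only [latticePoint, PiLp.add_apply, PiLp.smul_apply, smul_eq_mul] at h3
  have h4 : ξ i = -(2 * Real.pi * m i) := by linarith
  have h5 := hξ i
  rw [h4, Set.mem_Icc] at h5
  have h6 : |(m i : ℝ)| < 1 := by
    rw [abs_lt]
    constructor <;> nlinarith [Real.pi_pos]
  have h7 : m i = 0 := Int.abs_lt_one_iff.1 (by exact_mod_cast h6)
  rw [h4, h7]; simp

/-! ### Localization near the maximum and rescaling -/

theorem tendsto_rpow_mul_pow_zero (μ : ℝ) {ρ : ℝ} (h0 : 0 ≤ ρ) (h1 : ρ < 1) :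
    Tendsto (fun n : ℕ => (n : ℝ) ^ μ * ρ ^ n) atTop (𝓝 0) := by
  obtain ⟨k, hk⟩ := exists_nat_ge μ
  refine squeeze_zero' (Eventually.of_forall fun n => by positivity) ?_
    (tendsto_pow_const_mul_const_pow_of_abs_lt_one k (by rwa [abs_of_nonneg h0]))
  filter_upwards [eventually_ge_atTop 1] with n hn
  have hn' : (1 : ℝ) ≤ n := by exact_mod_cast hn
  gcongr
  calc (n : ℝ) ^ μ ≤ (n : ℝ) ^ (k : ℝ) := Real.rpow_le_rpow_of_exponent_le hn' hk
    _ = _ := Real.rpow_natCast _ _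

/-- Off `V` the modulus is at most some `ρ < 1` by compactness. The discarded part is at most `ρ^n`
times a volume, independently of `x`, and is negligible against every power of `n`. -/
theorem convPow_localization {φ : IntLattice d → ℂ} (hφ : Summable fun x => ‖φ x‖)
    (hsup : IsLUB (Set.range fun ξ : Space d => ‖fourierSeries φ ξ‖) 1)
    {ξ₀ : Space d} (hΩ : Omega φ = {ξ₀}) {V : Set (Space d)} (hV : IsOpen V) (h0 : 0 ∈ V)
    (hVc : V ⊆ cube d) (μ : ℝ) {ε : ℝ} (hε : 0 < ε) :
    ∃ N : ℕ, ∀ n : ℕ, N ≤ n → ∀ x : IntLattice d,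
      ‖(2 * (Real.pi : ℂ)) ^ d * convPow φ n x
        - ∫ ξ in V, fourierSeries φ (ξ + ξ₀) ^ n * chr (-latticePoint x) (ξ + ξ₀)‖
        ≤ ε * (n : ℝ) ^ (-μ) := by
  have hcont := continuous_fourierSeries hφ
  have hK : IsCompact (cube d \ V) := isCompact_cube.diff hV
  obtain ⟨ρ, hρ0, hρ1, hρ⟩ : ∃ ρ : ℝ, 0 ≤ ρ ∧ ρ < 1 ∧
      ∀ ξ ∈ cube d \ V, ‖fourierSeries φ (ξ + ξ₀)‖ ≤ ρ := by
    rcases Set.eq_empty_or_nonempty (cube d \ V) with h | h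
    · exact ⟨0, le_rfl, one_pos, fun ξ hξ => by rw [h] at hξ; exact hξ.elim⟩
    · obtain ⟨η, hη, hmax⟩ := hK.exists_isMaxOn h (f := fun ξ => ‖fourierSeries φ (ξ + ξ₀)‖)
        (by fun_prop)
      exact ⟨_, norm_nonneg _, norm_fourierSeries_lt_one hsup hΩ hη.1
        fun h => hη.2 (h ▸ h0), fun ξ hξ => hmax hξ⟩
  set B := volume.real (cube d \ V)
  have hlim := (tendsto_rpow_mul_pow_zero μ hρ0 hρ1).mul_const B
  rw [zero_mul] at hlim
  obtain ⟨N, hN⟩ := (hlim.eventually (Iio_mem_nhds hε)).exists_forall_of_atTop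
  -- The shift keeps `n` positive, as the transform of a convolution power is computed for indices
  -- `m + 1`.
  refine ⟨N + 1, fun n hn x => ?_⟩
  obtain ⟨m, rfl⟩ : ∃ m, n = m + 1 := ⟨n - 1, by omega⟩
  have hinv := fourier_inversion (summable_norm_convPow hφ m) ξ₀ x
  simp_rw [fourierSeries_convPow hφ] at hinv
  have hFc : Continuous fun ξ => fourierSeries φ (ξ + ξ₀) ^ (m + 1) *
      chr (-latticePoint x) (ξ + ξ₀) := by
    have := continuous_chr (-latticePoint x)
    fun_prop
  have hint := hFc.continuousOn.integrableOn_compact (μ := volume) (isCompact_cube (d := d))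
  rw [← hinv, ← setIntegral_sdiff hV.measurableSet hint hVc]
  have hbound : ‖∫ ξ in cube d \ V, fourierSeries φ (ξ + ξ₀) ^ (m + 1) *
      chr (-latticePoint x) (ξ + ξ₀)‖ ≤ ρ ^ (m + 1) * B := by
    refine norm_setIntegral_le_of_norm_le_const hK.measure_lt_top fun ξ hξ => ?_
    rw [norm_mul, norm_chr, mul_one, norm_pow]
    exact pow_le_pow_left₀ (norm_nonneg _) (hρ ξ hξ) _
  refine hbound.trans ?_
  have h2 : ((m + 1 : ℕ) : ℝ) ^ μ * ρ ^ (m + 1) * B < ε := hN (m + 1) (by omega)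
  have hpos : (0 : ℝ) < ((m + 1 : ℕ) : ℝ) ^ μ := Real.rpow_pos_of_pos (by positivity) _
  rw [Real.rpow_neg (by positivity), ← div_eq_mul_inv, le_div_iff₀ hpos]
  linarith

/-! ### Rescaling the local integral by `n^{-E}` -/

namespace GammaExpansion

variable {φ : IntLattice d → ℂ} {ξ₀ : Space d} (e : GammaExpansion φ ξ₀)

/-- The negative of the logarithm of `φ̂(ξ + ξ₀) / φ̂(ξ₀)` with the drift removed. -/
def phase (ξ : Space d) : ℂ :=
  Complex.I * ((polyFun e.Q ξ + e.Qt ξ : ℝ) : ℂ) + ((polyFun e.R ξ + e.Rt ξ : ℝ) : ℂ)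

theorem fourierSeries_pow {ξ : Space d} (hξ : ξ ∈ e.U) (hne : fourierSeries φ ξ₀ ≠ 0) (n : ℕ) :
    fourierSeries φ (ξ + ξ₀) ^ n = fourierSeries φ ξ₀ ^ n * chr ((n : ℝ) • e.α) ξ *
      Complex.exp (-(n * e.phase ξ)) := by
  have h1 : fourierSeries φ (ξ + ξ₀) = fourierSeries φ ξ₀ * Complex.exp (Gam φ ξ₀ ξ) := by
    rw [Gam, Complex.exp_log (Complex.slitPlane_ne_zero (e.mem_slitPlane ξ hξ)),
      mul_div_cancel₀ _ hne]
  rw [h1, mul_pow, ← Complex.exp_nat_mul, e.expansion ξ hξ, mul_assoc, chr, ← Complex.exp_add,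
    inner_smul_left, phase]
  congr 2
  push_cast
  simp only [conj_trivial, Complex.ofReal_natCast]
  ring

/-- The rescaled main integrand. -/
def scaledIntegrand (E : Space d →L[ℝ] Space d) (n : ℕ) (y η : Space d) : ℂ :=
  Complex.exp (-(n * e.phase (tpow (n : ℝ)⁻¹ E η))) * chr (-y) η

/-- The rescaled space variable. -/
def scaledPoint (E : Space d →L[ℝ] Space d) (n : ℕ) (x : IntLattice d) : Space d :=
  ContinuousLinearMap.adjoint (tpow (n : ℝ)⁻¹ E) (latticePoint x - (n : ℝ) • e.α)

/-- Substitution of `ξ = n^{-E} η`: the domain dilates to `{P < nδ}`, the Jacobian is `n^{-tr E}`,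
and the drift merges with `x` in the character, whose frequency is carried to the rescaled point by
the adjoint. -/
theorem setIntegral_fourierSeries_pow {P : Space d → ℝ} {E : Space d →L[ℝ] Space d}
    (hE : E ∈ exponentSet P) {δ : ℝ} (hP : Continuous P)
    (hU : {ξ | P ξ < δ} ⊆ e.U) (hne : fourierSeries φ ξ₀ ≠ 0) {n : ℕ} (hn : 0 < n)
    (x : IntLattice d) :
    ∫ ξ in {ξ | P ξ < δ}, fourierSeries φ (ξ + ξ₀) ^ n * chr (-latticePoint x) (ξ + ξ₀) =
      fourierSeries φ ξ₀ ^ n * chr (-latticePoint x) ξ₀ * ((n : ℝ) ^ (-trE E) : ℝ) *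
        ∫ η in {η | P η < n * δ}, e.scaledIntegrand E n (e.scaledPoint E n x) η := by
  have hn' : (0 : ℝ) < n := by exact_mod_cast hn
  have h1 := setIntegral_tpow (inv_pos.2 hn') E {ξ | P ξ < δ}
    (fun ξ => Complex.exp (-(n * e.phase ξ)) * chr (-(latticePoint x - (n : ℝ) • e.α)) ξ)
  rw [preimage_tpow_sublevel hE (inv_pos.2 hn'), div_inv_eq_mul, mul_comm δ] at h1
  have h2 : ∀ η, e.scaledIntegrand E n (e.scaledPoint E n x) η =
      Complex.exp (-(n * e.phase (tpow (n : ℝ)⁻¹ E η))) *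
        chr (-(latticePoint x - (n : ℝ) • e.α)) (tpow (n : ℝ)⁻¹ E η) := fun η => by
    rw [scaledIntegrand, scaledPoint, chr, chr, ← _root_.map_neg,
      ContinuousLinearMap.adjoint_inner_left]
  simp_rw [h2]
  rw [h1, Complex.real_smul]
  change _ = fourierSeries φ ξ₀ ^ n * chr (-latticePoint x) ξ₀ * ((n : ℝ) ^ (-trE E) : ℝ) *
    ((((n : ℝ)⁻¹ ^ trE E)⁻¹ : ℝ) * _)
  have h3 : ((n : ℝ) ^ (-trE E)) * ((n : ℝ)⁻¹ ^ trE E)⁻¹ = 1 := by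
    rw [Real.inv_rpow hn'.le, inv_inv, ← Real.rpow_add hn', neg_add_cancel, Real.rpow_zero]
  have h4 : (((n : ℝ) ^ (-trE E) : ℝ) : ℂ) * ((((n : ℝ)⁻¹ ^ trE E)⁻¹ : ℝ) : ℂ) = 1 := by
    rw [← Complex.ofReal_mul, h3, Complex.ofReal_one]
  have h5 : ∀ a b : ℂ, a * ((n : ℝ) ^ (-trE E) : ℝ) * ((((n : ℝ)⁻¹ ^ trE E)⁻¹ : ℝ) * b) = a * b :=
    fun a b => by linear_combination a * b * h4
  rw [h5, ← integral_const_mul]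
  refine setIntegral_congr_fun (measurableSet_lt hP.measurable measurable_const) fun ξ hξ => ?_
  rw [e.fourierSeries_pow (hU hξ) hne, chr_add_right, neg_sub, sub_eq_add_neg, chr_add_left]
  ring

end GammaExpansion

theorem norm_fourierSeries_eq_one {φ : IntLattice d → ℂ} {ξ₀ : Space d} (hΩ : Omega φ = {ξ₀}) :
    ‖fourierSeries φ ξ₀‖ = 1 :=
  (hΩ.symm ▸ Set.mem_singleton ξ₀ : ξ₀ ∈ Omega φ).2

/-- Reduction of a local limit theorem to a statement about the rescaled integrals. -/
theorem local_limit_of_scaled {φ : IntLattice d → ℂ} (hφ : Summable fun x => ‖φ x‖)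
    (hsup : IsLUB (Set.range fun ξ : Space d => ‖fourierSeries φ ξ‖) 1)
    {ξ₀ : Space d} (hΩ : Omega φ = {ξ₀}) (e : GammaExpansion φ ξ₀)
    {P : Space d → ℝ} (hP : IsPositiveHomogeneous P) {E : Space d →L[ℝ] Space d}
    (hE : E ∈ exponentSet P) {δ : ℝ} (hδ : 0 < δ) (hU : {ξ | P ξ < δ} ⊆ e.U)
    (hcube : {ξ | P ξ < δ} ⊆ cube d) (A : ℕ → Set (IntLattice d)) (H : ℕ → IntLattice d → ℂ)
    (hH : ∀ ε : ℝ, 0 < ε → ∃ N : ℕ, ∀ n : ℕ, N ≤ n → ∀ x ∈ A n,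
      ‖(∫ η in {η | P η < n * δ}, e.scaledIntegrand E n (e.scaledPoint E n x) η)
        - (2 * (Real.pi : ℂ)) ^ d * ((n : ℝ) ^ trE E : ℝ) * H n x‖ ≤ ε)
    {ε : ℝ} (hε : 0 < ε) :
    ∃ N : ℕ, ∀ n : ℕ, N ≤ n → ∀ x ∈ A n,
      ‖convPow φ n x - fourierSeries φ ξ₀ ^ n * chr (-latticePoint x) ξ₀ * H n x‖
        ≤ ε * (n : ℝ) ^ (-trE E) := by
  have h1 := norm_fourierSeries_eq_one hΩ
  have hne : fourierSeries φ ξ₀ ≠ 0 := norm_ne_zero_iff.1 (by rw [h1]; exact one_ne_zero)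
  obtain ⟨N₁, hN₁⟩ := convPow_localization hφ hsup hΩ (isOpen_lt hP.continuous continuous_const)
    (show (0 : Space d) ∈ {ξ | P ξ < δ} by simp [hP.map_zero, hδ]) hcube (trE E) (half_pos hε)
  obtain ⟨N₂, hN₂⟩ := hH (ε / 2) (half_pos hε)
  refine ⟨max 1 (max N₁ N₂), fun n hn x hx => ?_⟩
  have hn1 : 0 < n := lt_of_lt_of_le one_pos ((le_max_left _ _).trans hn)
  have hn' : (0 : ℝ) < n := by exact_mod_cast hn1
  have a := hN₁ n ((le_max_left _ _).trans ((le_max_right _ _).trans hn)) x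
  have b := hN₂ n ((le_max_right _ _).trans ((le_max_right _ _).trans hn)) x hx
  rw [e.setIntegral_fourierSeries_pow hE hP.continuous hU hne hn1] at a
  set J := ∫ η in {η | P η < n * δ}, e.scaledIntegrand E n (e.scaledPoint E n x) η
  set w := fourierSeries φ ξ₀ ^ n * chr (-latticePoint x) ξ₀
  have hw : ‖w‖ = 1 := by rw [norm_mul, norm_pow, h1, norm_chr, one_pow, mul_one]
  have hr : (0 : ℝ) < (n : ℝ) ^ (-trE E) := Real.rpow_pos_of_pos hn' _
  have hrr : (((n : ℝ) ^ (-trE E) : ℝ) : ℂ) * ((n : ℝ) ^ trE E : ℝ) = 1 := by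
    rw [← Complex.ofReal_mul, ← Real.rpow_add hn', neg_add_cancel, Real.rpow_zero,
      Complex.ofReal_one]
  set c : ℂ := (2 * (Real.pi : ℂ)) ^ d
  -- Since the normalizing constant has modulus at least 1, a bound for `c` times the error also
  -- bounds the error.
  have hc : 1 ≤ ‖c‖ := by
    rw [norm_pow, norm_mul, Complex.norm_real, Real.norm_of_nonneg Real.pi_pos.le]
    refine one_le_pow₀ ?_
    simp only [Complex.norm_ofNat]
    nlinarith [Real.pi_gt_three]
  have hsplit : c * (convPow φ n x - w * H n x) =
      (c * convPow φ n x - w * ((n : ℝ) ^ (-trE E) : ℝ) * J) +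
        w * ((n : ℝ) ^ (-trE E) : ℝ) * (J - c * ((n : ℝ) ^ trE E : ℝ) * H n x) := by
    linear_combination (c * w * H n x) * hrr
  have h3 : ‖c * (convPow φ n x - w * H n x)‖ ≤ ε * (n : ℝ) ^ (-trE E) := by
    rw [hsplit]
    refine (norm_add_le _ _).trans ?_
    rw [norm_mul (w * _), norm_mul w, hw, one_mul, Complex.norm_real, Real.norm_of_nonneg hr.le]
    nlinarith
  rw [norm_mul] at h3
  exact (le_mul_of_one_le_left (norm_nonneg _) hc).trans h3

/-! ### Points of positive homogeneous type -/

theorem continuous_polyFun (p : MvPolynomial (Fin d) ℝ) : Continuous (polyFun p) := by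
  unfold polyFun
  exact (MvPolynomial.continuous_eval p).comp (by fun_prop)

theorem attractorIntegrand_eq (P : Space d → ℂ) (t : ℝ) (x ξ : Space d) :
    attractorIntegrand P t x ξ = Complex.exp (-((t : ℂ) * P ξ)) * chr (-x) ξ := by
  rw [attractorIntegrand, chr_neg_left]

theorem continuous_attractorIntegrand {P : Space d → ℂ} (hP : Continuous P) (t : ℝ)
    (x : Space d) : Continuous (attractorIntegrand P t x) := by
  unfold attractorIntegrand; fun_prop

/-- Self-similarity of the attractor: the same substitution that rescales the convolution powers
reduces time `t` to time 1. -/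
theorem setIntegral_attractorIntegrand {P : Space d → ℂ} {E : Space d →L[ℝ] Space d}
    (hP : ∀ s : ℝ, 0 < s → ∀ ξ, P (tpow s E ξ) = s * P ξ) {t : ℝ} (ht : 0 < t) (x : Space d)
    (S : Set (Space d)) :
    ((t ^ trE E : ℝ) : ℂ) * ∫ ξ in S, attractorIntegrand P t x ξ =
      ∫ η in tpow t⁻¹ E ⁻¹' S,
        attractorIntegrand P 1 (ContinuousLinearMap.adjoint (tpow t⁻¹ E) x) η := by
  have h := setIntegral_tpow (inv_pos.2 ht) E S (attractorIntegrand P t x)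
  have h2 : ∀ η, attractorIntegrand P t x (tpow t⁻¹ E η) =
      attractorIntegrand P 1 (ContinuousLinearMap.adjoint (tpow t⁻¹ E) x) η := fun η => by
    rw [attractorIntegrand, attractorIntegrand, hP _ (inv_pos.2 ht),
      ContinuousLinearMap.adjoint_inner_left, ← mul_assoc, ← Complex.ofReal_mul,
      mul_inv_cancel₀ ht.ne']
  simp_rw [h2] at h
  rw [h, Complex.real_smul, Real.inv_rpow ht.le, inv_inv]
  rfl

theorem IsPositiveHomogeneous.exists_sublevel_subset {P : Space d → ℝ}
    (hP : IsPositiveHomogeneous P) {E : Space d →L[ℝ] Space d} (hE : E ∈ exponentSet P)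
    (hc : IsContracting E) {W : Set (Space d)} (hW : W ∈ 𝓝 (0 : Space d)) :
    ∃ δ : ℝ, 0 < δ ∧ {ξ | P ξ < δ} ⊆ W := by
  obtain ⟨r, hr, hrW⟩ := Metric.mem_nhds_iff.1 hW
  obtain ⟨δ, hδ, h⟩ := hP.exists_norm_lt hE hc hr
  exact ⟨δ, hδ, fun ξ hξ => hrW (mem_ball_zero_iff.2 (h ξ hξ))⟩

theorem cube_mem_nhds : cube d ∈ 𝓝 (0 : Space d) := by
  filter_upwards [Metric.ball_mem_nhds (0 : Space d) Real.pi_pos] with ξ hξ i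
  have h1 := (PiLp.norm_apply_le ξ i).trans (mem_ball_zero_iff.1 hξ).le
  exact abs_le.1 h1

/-- Polar coordinates, with `t = P(ξ)` and a base point on the unit level set, turn an estimate
along orbits into a pointwise comparison with `P`. -/
theorem IsPositiveHomogeneous.le_of_polar {P : Space d → ℝ}
    (hP : IsPositiveHomogeneous P) {E : Space d →L[ℝ] Space d} (hE : E ∈ exponentSet P)
    {f : Space d → ℝ} (hf0 : f 0 = 0) {ε τ : ℝ}
    (h : ∀ t : ℝ, 0 < t → t < τ → ∀ ξ ∈ {η | P η = 1}, |f (tpow t E ξ)| ≤ ε * t)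
    {ξ : Space d} (hξ : P ξ < τ) : |f ξ| ≤ ε * P ξ := by
  rcases eq_or_ne ξ 0 with rfl | h0
  · simp [hf0, hP.map_zero]
  obtain ⟨w, hw, hξw⟩ := exists_polar hE (hP.pos h0)
  have := h (P ξ) (hP.pos h0) hξ w hw
  rwa [← hξw] at this

theorem tendsto_mul_comp_tpow_inv {U : Set (Space d)} {f : Space d → ℝ}
    {E : Space d →L[ℝ] Space d}
    (h : ∀ ε : ℝ, 0 < ε → ∀ K : Set (Space d), IsCompact K →
      ∃ τ : ℝ, 0 < τ ∧ ∀ t : ℝ, 0 < t → t < τ → ∀ ξ ∈ K,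
        tpow t E ξ ∈ U ∧ |f (tpow t E ξ)| ≤ ε * t) (η : Space d) :
    Tendsto (fun n : ℕ => n * f (tpow (n : ℝ)⁻¹ E η)) atTop (𝓝 0) := by
  rw [Metric.tendsto_atTop]
  intro ε hε
  obtain ⟨τ, hτ, h⟩ := h (ε / 2) (half_pos hε) {η} isCompact_singleton
  obtain ⟨N, hN⟩ := exists_nat_gt τ⁻¹
  refine ⟨N, fun n hn => ?_⟩
  have h1 : τ⁻¹ < (n : ℝ) := hN.trans_le (by exact_mod_cast hn)
  have h2 : (0 : ℝ) < n := (inv_pos.2 hτ).trans h1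
  have h3 := (h _ (inv_pos.2 h2) (inv_lt_of_inv_lt₀ hτ h1) η rfl).2
  rw [dist_zero_right, Real.norm_eq_abs, abs_mul, abs_of_pos h2]
  calc _ ≤ n * (ε / 2 * (n : ℝ)⁻¹) := by gcongr
    _ = ε / 2 := by field_simp
    _ < ε := half_lt_self hε

namespace GammaExpansion

variable {φ : IntLattice d → ℂ} {ξ₀ : Space d} (e : GammaExpansion φ ξ₀)

theorem continuousOn_phase : ContinuousOn e.phase e.U := by
  have h1 := e.smooth_Qt.continuousOn
  have h2 := e.smooth_Rt.continuousOn
  have h3 := continuous_polyFun e.Q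
  have h4 := continuous_polyFun e.R
  unfold phase
  fun_prop

theorem norm_exp_neg_phase (n : ℕ) (ξ : Space d) :
    ‖Complex.exp (-(n * e.phase ξ))‖ = Real.exp (-(n * (polyFun e.R ξ + e.Rt ξ))) := by
  rw [Complex.norm_exp, phase]
  simp

theorem continuousOn_scaled {P : Space d → ℝ} {E : Space d →L[ℝ] Space d}
    (hE : E ∈ exponentSet P) {δ : ℝ} (hU : {ξ | P ξ < δ} ⊆ e.U) {n : ℕ} (hn : 0 < n) :
    ContinuousOn (fun η => Complex.exp (-(n * e.phase (tpow (n : ℝ)⁻¹ E η))))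
      {η | P η < n * δ} := by
  have hn' : (0 : ℝ) < n := by exact_mod_cast hn
  have h1 : ContinuousOn (fun η => e.phase (tpow (n : ℝ)⁻¹ E η)) {η | P η < n * δ} :=
    e.continuousOn_phase.comp (tpow (n : ℝ)⁻¹ E).continuous.continuousOn fun η hη => hU (by
      have : η ∈ tpow (n : ℝ)⁻¹ E ⁻¹' {ξ | P ξ < δ} := by
        rw [preimage_tpow_sublevel hE (inv_pos.2 hn'), div_inv_eq_mul, mul_comm]; exact hη
      exact this)
  fun_prop

theorem integrableOn_scaled {P : Space d → ℝ} (hP : IsPositiveHomogeneous P)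
    {E : Space d →L[ℝ] Space d} (hE : E ∈ exponentSet P) (hc : IsContracting E) {δ : ℝ}
    (hU : {ξ | P ξ < δ} ⊆ e.U) (hpos : ∀ ξ, P ξ < δ → 0 ≤ polyFun e.R ξ + e.Rt ξ)
    {n : ℕ} (hn : 0 < n) (y : Space d) :
    IntegrableOn (e.scaledIntegrand E n y) {η | P η < n * δ} := by
  have hn' : (0 : ℝ) < n := by exact_mod_cast hn
  have hm : MeasurableSet {η | P η < n * δ} :=
    measurableSet_lt hP.continuous.measurable measurable_const
  have hfin : volume {η | P η < n * δ} ≠ ⊤ :=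
    ((measure_mono fun ξ (h : P ξ < n * δ) => h.le).trans_lt
      (hP.isCompact_le hE hc _).measure_lt_top).ne
  have hcont := (e.continuousOn_scaled hE hU hn).mul (continuous_chr (-y)).continuousOn
  refine (integrableOn_const (C := (1 : ℝ)) hfin).mono' (hcont.aestronglyMeasurable hm)
    ((ae_restrict_iff' hm).2 (Eventually.of_forall fun η hη => ?_))
  rw [scaledIntegrand, norm_mul, norm_chr, mul_one, norm_exp_neg_phase, Real.exp_le_one_iff]
  have h1 : P (tpow (n : ℝ)⁻¹ E η) < δ := by
    rw [hE _ (inv_pos.2 hn'), inv_mul_lt_iff₀ hn']; exact hη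
  have := mul_nonneg hn'.le (hpos _ h1)
  linarith

variable {e}

theorem norm_attractorIntegrand_P (t : ℝ) (x ξ : Space d) :
    ‖attractorIntegrand e.P t x ξ‖ = Real.exp (-(t * polyFun e.R ξ)) := by
  rw [attractorIntegrand_eq, norm_mul, norm_chr, mul_one, Complex.norm_exp, P]
  simp

theorem continuous_P : Continuous e.P := by
  have h3 := continuous_polyFun e.Q
  have h4 := continuous_polyFun e.R
  unfold P
  fun_prop

theorem IsPositiveType.integrable (h : e.IsPositiveType) {t : ℝ} (ht : 0 < t) (x : Space d) :
    Integrable (attractorIntegrand e.P t x) := by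
  obtain ⟨hR, E, hE, -, hsR, -⟩ := h
  refine (hR.integrable_exp_neg hE hsR.1 ht).mono'
    (continuous_attractorIntegrand continuous_P t x).aestronglyMeasurable
    (Eventually.of_forall fun ξ => (norm_attractorIntegrand_P t x ξ).le)

/-- On `{R < δ}` the remainder satisfies `|R̃| ≤ R/2`, so by homogeneity the rescaled exponent has
real part at most `-R(η)/2`, independently of `n`, and dominated convergence applies. The character
is left out because it has modulus 1; this is what makes the resulting estimate uniform in `x`. -/
theorem IsPositiveType.tendsto_L1 {E : Space d →L[ℝ] Space d}
    (hR : IsPositiveHomogeneous (polyFun e.R)) (hE : E ∈ exponentSet (polyFun e.R))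
    (hEQ : E ∈ exponentSet (polyFun e.Q)) (hsR : IsSubhomogeneous e.U e.Rt E)
    (hsQ : IsSubhomogeneous e.U e.Qt E) {δ : ℝ} (hδ : 0 < δ)
    (hU : {ξ | polyFun e.R ξ < δ} ⊆ e.U)
    (hb : ∀ ξ, polyFun e.R ξ < δ → |e.Rt ξ| ≤ 1 / 2 * polyFun e.R ξ) :
    Tendsto (fun n : ℕ => ∫ η, ‖Set.indicator {η | polyFun e.R η < n * δ}
      (fun η => Complex.exp (-(n * e.phase (tpow (n : ℝ)⁻¹ E η)))) η -
        Complex.exp (-e.P η)‖) atTop (𝓝 0) := by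
  have hRc := continuous_polyFun e.R
  have hPc := continuous_P (e := e)
  rw [← integral_zero (Space d) ℝ (μ := volume)]
  have hexp : ∀ η, ‖Complex.exp (-e.P η)‖ = Real.exp (-polyFun e.R η) := fun η => by
    rw [Complex.norm_exp, P]; simp
  refine tendsto_integral_filter_of_dominated_convergence
    (fun η => 2 * Real.exp (-(1 / 2 * polyFun e.R η))) ?_ ?_
    ((hR.integrable_exp_neg hE hsR.1 one_half_pos).const_mul 2) ?_
  · filter_upwards [eventually_gt_atTop 0] with n hn
    refine AEStronglyMeasurable.norm (AEStronglyMeasurable.sub ?_ (by fun_prop))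
    have hm : MeasurableSet {η | polyFun e.R η < n * δ} :=
      measurableSet_lt hRc.measurable measurable_const
    exact (aestronglyMeasurable_indicator_iff hm).2
      ((e.continuousOn_scaled hE hU hn).aestronglyMeasurable hm)
  · filter_upwards [eventually_gt_atTop 0] with n hn
    have hn' : (0 : ℝ) < n := by exact_mod_cast hn
    refine Eventually.of_forall fun η => ?_
    rw [norm_norm, two_mul]
    have h0 := hR.nonneg η
    refine (norm_sub_le _ _).trans (add_le_add ?_ ?_)
    · rw [Set.indicator_apply]
      split_ifs with hη
      · rw [norm_exp_neg_phase, Real.exp_le_exp]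
        have h1 : polyFun e.R (tpow (n : ℝ)⁻¹ E η) = (n : ℝ)⁻¹ * polyFun e.R η :=
          hE _ (inv_pos.2 hn') η
        have h2 : (n : ℝ)⁻¹ * polyFun e.R η < δ := by
          rw [inv_mul_lt_iff₀ hn']; exact hη
        have h3 := (abs_le.1 (hb (tpow (n : ℝ)⁻¹ E η) (h1 ▸ h2))).1
        rw [h1] at h3 ⊢
        have h4 : (n : ℝ) * ((n : ℝ)⁻¹ * polyFun e.R η) = polyFun e.R η :=
          mul_inv_cancel_left₀ hn'.ne' _
        nlinarith
      · rw [norm_zero]; positivity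
    · rw [hexp, Real.exp_le_exp]; linarith
  · refine Eventually.of_forall fun η => ?_
    have hlim : Tendsto (fun n : ℕ => e.P η + (Complex.I *
        ((n * e.Qt (tpow (n : ℝ)⁻¹ E η) : ℝ) : ℂ) + ((n * e.Rt (tpow (n : ℝ)⁻¹ E η) : ℝ) : ℂ)))
        atTop (𝓝 (e.P η + (Complex.I * ((0 : ℝ) : ℂ) + ((0 : ℝ) : ℂ)))) :=
      tendsto_const_nhds.add (((Complex.continuous_ofReal.tendsto _).comp
        (tendsto_mul_comp_tpow_inv hsQ.2.2 η)).const_mul _ |>.add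
          ((Complex.continuous_ofReal.tendsto _).comp (tendsto_mul_comp_tpow_inv hsR.2.2 η)))
    simp only [Complex.ofReal_zero, mul_zero, add_zero] at hlim
    have hlim2 := ((hlim.neg.cexp).sub_const (Complex.exp (-e.P η))).norm
    rw [sub_self, norm_zero] at hlim2
    refine hlim2.congr' ?_
    have hev : ∀ᶠ n : ℕ in atTop, polyFun e.R η < n * δ :=
      (tendsto_natCast_atTop_atTop.atTop_mul_const hδ).eventually_gt_atTop _
    filter_upwards [hev, eventually_gt_atTop 0] with n h1 hn
    have hn' : (0 : ℝ) < n := by exact_mod_cast hn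
    rw [Set.indicator_of_mem (show η ∈ {η | polyFun e.R η < n * δ} from h1), phase, P,
      hE _ (inv_pos.2 hn'), hEQ _ (inv_pos.2 hn')]
    congr 4
    have hnc : (n : ℂ) ≠ 0 := by exact_mod_cast hn.ne'
    push_cast
    field_simp
    ring

theorem IsPositiveType.local_limit (hφ : Summable fun x => ‖φ x‖)
    (hsup : IsLUB (Set.range fun ξ : Space d => ‖fourierSeries φ ξ‖) 1)
    (hΩ : Omega φ = {ξ₀}) (h : e.IsPositiveType) {ε : ℝ} (hε : 0 < ε) :
    ∃ N : ℕ, ∀ n : ℕ, N ≤ n → ∀ x : IntLattice d,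
      ‖convPow φ n x - fourierSeries φ ξ₀ ^ n * chr (-latticePoint x) ξ₀ *
        attractor e.P (n : ℝ) (latticePoint x - (n : ℝ) • e.α)‖
          ≤ ε * (n : ℝ) ^ (-homOrder (polyFun e.R)) := by
  have hint := fun t ht x => h.integrable (t := t) ht x
  obtain ⟨hR, E, hE, hEQ, hsR, hsQ⟩ := h
  rw [hR.homOrder_eq hE hsR.1]
  obtain ⟨δ₁, hδ₁, hU⟩ := hR.exists_sublevel_subset hE hsR.1
    (inter_mem (e.isOpen_U.mem_nhds e.zero_mem_U) cube_mem_nhds)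
  obtain ⟨τ, hτ, hb⟩ := hsR.2.2 (1 / 2) one_half_pos _ hR.isCompact_level
  -- One constraint keeps the sublevel set inside `U` and the cube, the other secures `|R̃| ≤ R/2`
  -- on it.
  set δ := min δ₁ τ
  have hδ : 0 < δ := lt_min hδ₁ hτ
  have hsub : {ξ | polyFun e.R ξ < δ} ⊆ e.U ∩ cube d := fun ξ hξ =>
    hU (show polyFun e.R ξ < δ₁ from lt_of_lt_of_le hξ (min_le_left _ _))
  have hb' : ∀ ξ, polyFun e.R ξ < δ → |e.Rt ξ| ≤ 1 / 2 * polyFun e.R ξ := fun ξ hξ =>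
    hR.le_of_polar hE e.Rt_zero (fun t h1 h2 w hw => (hb t h1 h2 w hw).2)
      (hξ.trans_le (min_le_right _ _))
  have hL1 := tendsto_L1 hR hE hEQ hsR hsQ hδ (fun ξ hξ => (hsub hξ).1) hb'
  refine (local_limit_of_scaled hφ hsup hΩ e hR hE hδ (fun ξ hξ => (hsub hξ).1)
    (fun ξ hξ => (hsub hξ).2) (fun _ => Set.univ)
    (fun n x => attractor e.P (n : ℝ) (latticePoint x - (n : ℝ) • e.α)) (fun ε' hε' => ?_) hε).imp
      fun N hN n hn x => hN n hn x trivial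
  obtain ⟨N, hN⟩ := (hL1.eventually (Iio_mem_nhds hε')).exists_forall_of_atTop
  refine ⟨N + 1, fun n hn x _ => ?_⟩
  have hn' : (0 : ℝ) < n := by exact_mod_cast (by omega : 0 < n)
  refine le_trans ?_ (le_of_lt (hN n (by omega)))
  have hhom : ∀ s : ℝ, 0 < s → ∀ ξ, e.P (tpow s E ξ) = s * e.P ξ := fun s hs ξ => by
    rw [P, P, hE s hs, hEQ s hs]; push_cast; ring
  have hscale := setIntegral_attractorIntegrand hhom hn' (latticePoint x - (n : ℝ) • e.α) Set.univ
  rw [Set.preimage_univ, setIntegral_univ, setIntegral_univ] at hscale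
  have hpi : ((2 * (Real.pi : ℂ)) ^ d) ≠ 0 :=
    pow_ne_zero _ (mul_ne_zero two_ne_zero (by exact_mod_cast Real.pi_ne_zero))
  have hmain : (2 * (Real.pi : ℂ)) ^ d * ((n : ℝ) ^ trE E : ℝ) *
      attractor e.P (n : ℝ) (latticePoint x - (n : ℝ) • e.α) =
      ∫ η, attractorIntegrand e.P 1 (e.scaledPoint E n x) η := by
    rw [scaledPoint, ← hscale, attractor]
    field_simp
  have hm : MeasurableSet {η | polyFun e.R η < n * δ} :=
    measurableSet_lt (continuous_polyFun e.R).measurable measurable_const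
  rw [hmain, ← integral_indicator hm, ← integral_sub]
  · refine (norm_integral_le_integral_norm _).trans (le_of_eq (integral_congr_ae
      (Eventually.of_forall fun η => ?_)))
    simp only
    have h2 : Set.indicator {η | polyFun e.R η < n * δ}
        (fun η => e.scaledIntegrand E n (e.scaledPoint E n x) η) η =
        Set.indicator {η | polyFun e.R η < n * δ}
          (fun η => Complex.exp (-(n * e.phase (tpow (n : ℝ)⁻¹ E η)))) η *
            chr (-e.scaledPoint E n x) η := by
      rw [Set.indicator_apply, Set.indicator_apply]
      split_ifs
      · rfl
      · rw [zero_mul]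
    rw [h2, attractorIntegrand_eq, Complex.ofReal_one, one_mul, ← sub_mul, norm_mul, norm_chr,
      mul_one]
  · rw [integrable_indicator_iff hm]
    refine e.integrableOn_scaled hR hE hsR.1 (fun ξ hξ => (hsub hξ).1) (fun ξ hξ => ?_) (by omega) _
    have h1 := (abs_le.1 (hb' ξ hξ)).1
    have h2 := hR.nonneg ξ
    linarith
  · exact hint 1 one_pos _

end GammaExpansion

/-! ### A one-dimensional oscillatory integral -/

/-- One integration by parts: `B = i e^{-if} A / f'` is a primitive of the integrand up to an error
`O(x^{μ-2})`, which is integrable at infinity as `μ < 1`. The two boundary terms give the 4 in the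
constant, and the error gives `C / (1 - μ)`. -/
theorem norm_integral_oscillatory_le {μ a b C₁ C₂ : ℝ} (hμ : μ < 1) (ha : 0 < a) (hab : a ≤ b)
    {f f' f'' A A' : ℝ → ℝ} (hf : ∀ x ∈ Set.Icc a b, HasDerivAt f (f' x) x)
    (hf' : ∀ x ∈ Set.Icc a b, HasDerivAt f' (f'' x) x)
    (hA : ∀ x ∈ Set.Icc a b, HasDerivAt A (A' x) x)
    (h1 : ∀ x ∈ Set.Icc a b, 1 / 2 ≤ |f' x|) (h2 : ∀ x ∈ Set.Icc a b, |f'' x| ≤ C₁ * x⁻¹)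
    (h3 : ∀ x ∈ Set.Icc a b, |A x| ≤ x ^ (μ - 1))
    (h4 : ∀ x ∈ Set.Icc a b, |A' x| ≤ C₂ * x ^ (μ - 2)) :
    ‖∫ x in a..b, Complex.exp (-(Complex.I * f x)) * A x‖ ≤
      (4 + (2 * C₂ + 4 * C₁) / (1 - μ)) * a ^ (μ - 1) := by
  set C := 2 * C₂ + 4 * C₁
  let u : ℝ → ℂ := fun x => Complex.exp (-(Complex.I * f x)) * A x
  let B : ℝ → ℂ := fun x => Complex.exp (-(Complex.I * f x)) * (Complex.I * ((A x / f' x : ℝ) : ℂ))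
  have hne : ∀ x ∈ Set.Icc a b, f' x ≠ 0 := fun x hx h => by
    have := h1 x hx; rw [h, abs_zero] at this; linarith
  have hexp : ∀ x ∈ Set.Icc a b, HasDerivAt (fun x => Complex.exp (-(Complex.I * f x)))
      (Complex.exp (-(Complex.I * f x)) * (-(Complex.I * f' x))) x := fun x hx =>
    (((hf x hx).ofReal_comp).const_mul Complex.I).neg.cexp
  have hB : ∀ x ∈ Set.Icc a b, HasDerivAt B (u x + Complex.exp (-(Complex.I * f x)) *
      (Complex.I * (((A' x * f' x - A x * f'' x) / f' x ^ 2 : ℝ) : ℂ))) x := fun x hx => by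
    have hq := (((hA x hx).div (hf' x hx) (hne x hx)).ofReal_comp).const_mul Complex.I
    refine ((hexp x hx).mul hq).congr_deriv ?_
    have : (f' x : ℂ) ≠ 0 := by exact_mod_cast hne x hx
    simp only [u, Pi.div_apply]
    push_cast
    have hI : Complex.I * Complex.I = -1 := Complex.I_mul_I
    field_simp
    linear_combination (-(A x : ℂ) * (f' x) ^ 2) * hI
  have hucont : ContinuousOn u (Set.Icc a b) := fun x hx =>
    ((hexp x hx).continuousAt.mul (hA x hx).ofReal_comp.continuousAt).continuousWithinAt
  -- A continuous extension to the whole line makes the primitive differentiable on both sides at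
  -- the endpoints.
  let g : ℝ → ℂ := Set.IccExtend hab ((Set.Icc a b).domRestrict u)
  have hg : Continuous g := hucont.domRestrict.Icc_extend'
  have hgu : ∀ x ∈ Set.Icc a b, g x = u x := fun x hx => Set.IccExtend_of_mem hab _ hx
  let J : ℝ → ℂ := fun x => (∫ s in a..x, g s) - B x
  have hJ : ∀ x ∈ Set.Icc a b, HasDerivAt J (-(Complex.exp (-(Complex.I * f x)) *
      (Complex.I * (((A' x * f' x - A x * f'' x) / f' x ^ 2 : ℝ) : ℂ)))) x := fun x hx => by
    refine ((hg.integral_hasStrictDerivAt a x).hasDerivAt.sub (hB x hx)).congr_deriv ?_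
    rw [hgu x hx]; ring
  have hBn : ∀ x ∈ Set.Icc a b, ‖B x‖ ≤ 2 * x ^ (μ - 1) := fun x hx => by
    have hfx := h1 x hx
    rw [norm_mul, mul_comm Complex.I (f x : ℂ), ← neg_mul, ← Complex.ofReal_neg,
      Complex.norm_exp_ofReal_mul_I, one_mul, norm_mul, Complex.norm_I, one_mul, Complex.norm_real,
      Real.norm_eq_abs, abs_div, div_le_iff₀ (by linarith)]
    nlinarith [h3 x hx, abs_nonneg (A x)]
  have hbound : ∀ x ∈ Set.Icc a b, ‖-(Complex.exp (-(Complex.I * f x)) *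
      (Complex.I * (((A' x * f' x - A x * f'' x) / f' x ^ 2 : ℝ) : ℂ)))‖ ≤ C * x ^ (μ - 2) :=
    fun x hx => by
    have hx0 : 0 < x := ha.trans_le hx.1
    have hfx := h1 x hx
    rw [norm_neg, norm_mul, mul_comm Complex.I (f x : ℂ), ← neg_mul, ← Complex.ofReal_neg,
      Complex.norm_exp_ofReal_mul_I, one_mul, norm_mul, Complex.norm_I, one_mul, Complex.norm_real,
      Real.norm_eq_abs]
    have e1 : (A' x * f' x - A x * f'' x) / f' x ^ 2 = A' x / f' x - A x * f'' x / f' x ^ 2 := by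
      have := hne x hx
      field_simp
    rw [e1]
    refine (abs_sub _ _).trans ?_
    have p1 : |A' x / f' x| ≤ 2 * (C₂ * x ^ (μ - 2)) := by
      rw [abs_div, div_le_iff₀ (by linarith)]
      nlinarith [h4 x hx, abs_nonneg (A' x)]
    have p2 : |A x * f'' x / f' x ^ 2| ≤ 4 * (C₁ * x ^ (μ - 2)) := by
      have q1 : |A x * f'' x| ≤ C₁ * x ^ (μ - 2) := by
        rw [abs_mul]
        calc |A x| * |f'' x| ≤ x ^ (μ - 1) * (C₁ * x⁻¹) :=
              mul_le_mul (h3 x hx) (h2 x hx) (abs_nonneg _) (by positivity)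
          _ = C₁ * x ^ (μ - 2) := by
              rw [show μ - 2 = μ - 1 - 1 by ring, Real.rpow_sub_one hx0.ne' (μ - 1)]; ring
      have q2 : (1 : ℝ) / 4 ≤ f' x ^ 2 := by rw [← sq_abs]; nlinarith
      rw [abs_div, abs_of_nonneg (sq_nonneg (f' x)), div_le_iff₀ (by linarith)]
      nlinarith [abs_nonneg (A x * f'' x)]
    simp only [C]; linarith
  -- An explicit majorant with derivative `C x^{μ-2}`: comparing derivatives bounds `J` without
  -- integrating the error term.
  have hpow : ∀ x ∈ Set.Icc a b, HasDerivAt (fun x => ‖J a‖ + C / (1 - μ) *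
      (a ^ (μ - 1) - x ^ (μ - 1))) (C * x ^ (μ - 2)) x := fun x hx => by
    have hx0 : 0 < x := ha.trans_le hx.1
    have := ((Real.hasDerivAt_rpow_const (p := μ - 1) (Or.inl hx0.ne')).const_sub
      (a ^ (μ - 1))).const_mul (C / (1 - μ)) |>.const_add ‖J a‖
    refine this.congr_deriv ?_
    have : 1 - μ ≠ 0 := by linarith
    rw [show μ - 1 - 1 = μ - 2 by ring]
    field_simp
    ring
  have hJb : ‖J b‖ ≤ ‖J a‖ + C / (1 - μ) * (a ^ (μ - 1) - b ^ (μ - 1)) := by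
    refine image_norm_le_of_norm_deriv_right_le_deriv_boundary' (a := a) (b := b)
      (fun x hx => (hJ x hx).continuousAt.continuousWithinAt)
      (fun x hx => (hJ x (Set.Ico_subset_Icc_self hx)).hasDerivWithinAt)
      (B := fun x => ‖J a‖ + C / (1 - μ) * (a ^ (μ - 1) - x ^ (μ - 1))) ?_
      (fun x hx => (hpow x hx).continuousAt.continuousWithinAt)
      (fun x hx => (hpow x (Set.Ico_subset_Icc_self hx)).hasDerivWithinAt)
      (fun x hx => hbound x (Set.Ico_subset_Icc_self hx)) (Set.right_mem_Icc.2 hab)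
    simp
  have hb0 : 0 < b := ha.trans_le hab
  -- No signs of `C₁`, `C₂` are assumed; nonnegativity is read off from the bound on a norm at `a`.
  have hC : 0 ≤ C := by
    have := (norm_nonneg _).trans (hbound a (Set.left_mem_Icc.2 hab))
    exact nonneg_of_mul_nonneg_left this (Real.rpow_pos_of_pos ha _)
  have hba : b ^ (μ - 1) ≤ a ^ (μ - 1) := Real.rpow_le_rpow_of_nonpos ha hab (by linarith)
  have hJa : ‖J a‖ ≤ 2 * a ^ (μ - 1) := by
    simpa [J] using hBn a (Set.left_mem_Icc.2 hab)
  have hint : ∫ x in a..b, Complex.exp (-(Complex.I * f x)) * A x = J b + B b := by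
    simp only [J, sub_add_cancel]
    refine intervalIntegral.integral_congr fun x hx => ?_
    rw [Set.uIcc_of_le hab] at hx
    exact (hgu x hx).symm
  rw [hint]
  have hfin := norm_add_le (J b) (B b)
  have hBb := hBn b (Set.right_mem_Icc.2 hab)
  have hD : 0 ≤ C / (1 - μ) := div_nonneg hC (by linarith)
  have : 0 ≤ C / (1 - μ) * b ^ (μ - 1) := by positivity
  nlinarith

/-! ### Integration along the orbits of a contracting group -/

theorem measurable_tpow_apply (E : Space d →L[ℝ] Space d) :
    Measurable fun p : ℝ × Space d => tpow p.1 E p.2 := by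
  have hc : Continuous fun p : ℝ × Space d => NormedSpace.exp (p.1 • E) p.2 := by
    let _ : NormedAlgebra ℚ (Space d →L[ℝ] Space d) := NormedAlgebra.restrictScalars ℚ ℝ _
    have h1 : Continuous fun p : ℝ × Space d => NormedSpace.exp (p.1 • E) :=
      NormedSpace.exp_continuous.comp (continuous_fst.smul continuous_const)
    exact h1.clm_apply continuous_snd
  exact hc.measurable.comp ((Real.measurable_log.comp measurable_fst).prodMk measurable_snd)

/-- The measure `ds/s` is dilation invariant, so `(p/2, p]` has mass `log 2` for every `p`. This is
the averaging weight that replaces a surface measure. -/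
theorem integral_Ioi_indicator_inv {p : ℝ} (hp : 0 < p) :
    ∫ s in Set.Ioi (0 : ℝ), Set.indicator {s : ℝ | s ≤ p ∧ p < 2 * s} (fun s => s⁻¹) s =
      Real.log 2 := by
  have hset : {s : ℝ | s ≤ p ∧ p < 2 * s} = Set.Ioc (p / 2) p := by
    ext s; simp only [Set.mem_ofPred_eq, Set.mem_Ioc]
    constructor <;> rintro ⟨h1, h2⟩ <;> constructor <;> linarith
  rw [hset, setIntegral_indicator measurableSet_Ioc, Set.inter_eq_right.2
    (show Set.Ioc (p / 2) p ⊆ Set.Ioi 0 from fun s hs => (half_pos hp).trans hs.1),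
    ← intervalIntegral.integral_of_le (by linarith), integral_inv_of_pos (half_pos hp) hp]
  congr 1; field_simp

theorem integrableOn_Ioi_indicator_inv {p : ℝ} (hp : 0 < p) :
    IntegrableOn (Set.indicator {s : ℝ | s ≤ p ∧ p < 2 * s} (fun s => s⁻¹)) (Set.Ioi 0) := by
  -- A non-integrable function has integral 0 by convention, whereas the value found is `log 2`.
  by_contra h
  have h2 := integral_undef h
  rw [integral_Ioi_indicator_inv hp] at h2
  exact (Real.log_pos one_lt_two).ne' h2

/-- Polar coordinates, with the unital level set thickened to the shell `{1 ≤ P < 2}`. -/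
theorem log_two_smul_integral_eq {P : Space d → ℝ} (hP : Continuous P)
    {E : Space d →L[ℝ] Space d} (hE : E ∈ exponentSet P) {G : Space d → ℂ} (hGm : Measurable G)
    (hGi : Integrable G) (hG0 : ∀ η, P η ≤ 0 → G η = 0) :
    Real.log 2 • ∫ η, G η = ∫ w in {w | 1 ≤ P w ∧ P w < 2},
      ∫ s in Set.Ioi (0 : ℝ), (s ^ (trE E - 1)) • G (tpow s E w) := by
  set ν := (volume : Measure ℝ).restrict (Set.Ioi 0)
  let T : Set (ℝ × Space d) := {p | p.1 ≤ P p.2 ∧ P p.2 < 2 * p.1}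
  have hT : MeasurableSet T :=
    (measurableSet_le measurable_fst (hP.measurable.comp measurable_snd)).inter
      (measurableSet_lt (hP.measurable.comp measurable_snd) (measurable_fst.const_mul 2))
  let k : ℝ × Space d → ℝ := T.indicator fun p => p.1⁻¹
  have hk : Measurable k := measurable_fst.inv.indicator hT
  -- Integrating the weight `k` over `s` gives `log 2` wherever `P > 0`. Taking the integral over
  -- space first allows the substitution `η = s^E w` for each fixed `s`.
  let F : ℝ × Space d → ℂ := fun p => k p • G p.2
  have hFm : Measurable F := hk.smul (hGm.comp measurable_snd)
  have hk0 : ∀ p, 0 ≤ k p := fun p => Set.indicator_nonneg (fun p hp => by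
    have := hp.1; have := hp.2; exact inv_nonneg.2 (by linarith)) p
  have hFn : ∀ p, ‖F p‖ = k p * ‖G p.2‖ := fun p => by
    rw [norm_smul, Real.norm_of_nonneg (hk0 p)]
  have hki : ∀ η, 0 < P η → Integrable (fun s => k (s, η)) ν := fun η hη =>
    integrableOn_Ioi_indicator_inv hη
  have hkl : ∀ η, 0 < P η → ∫ s, k (s, η) ∂ν = Real.log 2 := fun η hη =>
    integral_Ioi_indicator_inv hη
  have hF : Integrable F (ν.prod volume) := by
    refine (integrable_prod_iff' hFm.aestronglyMeasurable).2
      ⟨Eventually.of_forall fun η => ?_, (hGi.norm.const_mul (Real.log 2)).congr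
        (Eventually.of_forall fun η => ?_)⟩
    · rcases le_or_gt (P η) 0 with h | h
      · simp [F, hG0 η h]
      · exact (hki η h).smul_const (G η)
    · simp only [hFn]
      rcases le_or_gt (P η) 0 with h | h
      · simp [hG0 η h]
      · rw [integral_mul_const, hkl η h]
  let F₂ : ℝ × Space d → ℂ := fun p => (p.1 ^ trE E) • F (p.1, tpow p.1 E p.2)
  have hF₂m : Measurable F₂ := (measurable_fst.pow_const _).smul
    (hFm.comp (measurable_fst.prodMk (measurable_tpow_apply E)))
  have hcv : ∀ s, 0 < s → ∫ w, ‖F₂ (s, w)‖ = ∫ η, ‖F (s, η)‖ := fun s hs => by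
    simp only [F₂, norm_smul]
    rw [integral_const_mul, integral_tpow hs E (fun η => ‖F (s, η)‖), smul_eq_mul, ← mul_assoc,
      Real.norm_of_nonneg (Real.rpow_nonneg hs.le _)]
    exact mul_left_eq_self₀.2 (Or.inl (mul_inv_cancel₀ (Real.rpow_pos_of_pos hs _).ne'))
  have hF₂ : Integrable F₂ (ν.prod volume) := by
    refine (integrable_prod_iff hF₂m.aestronglyMeasurable).2 ⟨?_, ?_⟩
    · filter_upwards [hF.prod_right_ae, ae_restrict_mem measurableSet_Ioi] with s h1 hs
      exact (integrable_comp_tpow hs E h1).smul (s ^ trE E)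
    · refine hF.integral_norm_prod_left.congr ?_
      filter_upwards [ae_restrict_mem measurableSet_Ioi] with s hs
      exact (hcv s hs).symm
  have hW : MeasurableSet {w | 1 ≤ P w ∧ P w < 2} :=
    (measurableSet_le measurable_const hP.measurable).inter
      (measurableSet_lt hP.measurable measurable_const)
  calc Real.log 2 • ∫ η, G η = ∫ η, ∫ s, F (s, η) ∂ν := by
        rw [← integral_smul]
        refine integral_congr_ae (Eventually.of_forall fun η => ?_)
        simp only [F]
        rcases le_or_gt (P η) 0 with h | h
        · simp [hG0 η h]
        · rw [integral_smul_const, hkl η h]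
    _ = ∫ s, (∫ η, F (s, η)) ∂ν := (integral_integral_swap hF).symm
    _ = ∫ s, (∫ w, F₂ (s, w)) ∂ν := by
        refine integral_congr_ae ?_
        filter_upwards [ae_restrict_mem measurableSet_Ioi] with s hs
        simp only [F₂]
        rw [integral_smul, integral_tpow hs E (fun η => F (s, η)), smul_smul]
        change _ = (s ^ trE E * (s ^ trE E)⁻¹) • _
        rw [mul_inv_cancel₀ (Real.rpow_pos_of_pos hs _).ne', one_smul]
    _ = ∫ w, ∫ s, F₂ (s, w) ∂ν := integral_integral_swap hF₂
    _ = _ := by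
        rw [← integral_indicator hW]
        refine integral_congr_ae (Eventually.of_forall fun w => ?_)
        have hk2 : ∀ s ∈ Set.Ioi (0 : ℝ), F₂ (s, w) = Set.indicator {w | 1 ≤ P w ∧ P w < 2}
            (fun w => (s ^ (trE E - 1)) • G (tpow s E w)) w := fun s hs => by
          have hs : 0 < s := hs
          simp only [F₂, F, k, T, Set.indicator_apply, Set.mem_ofPred_eq, hE s hs w]
          -- By homogeneity the support condition on the weight loses its dependence on `s` and
          -- becomes membership of `w` in the shell.
          have : (s ≤ s * P w ∧ s * P w < 2 * s) ↔ (1 ≤ P w ∧ P w < 2) := by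
            rw [le_mul_iff_one_le_right hs, mul_comm 2 s, mul_lt_mul_iff_right₀ hs]
          simp only [this]
          split_ifs
          · rw [smul_smul, Real.rpow_sub_one hs.ne', div_eq_mul_inv]
          · simp
        simp only
        rw [setIntegral_congr_fun measurableSet_Ioi hk2]
        simp only [Set.indicator_apply]
        split_ifs
        · rfl
        · simp

/-- Absolute bound for an integral over `{a ≤ P < b}` by integrals along orbits. -/
theorem norm_setIntegral_shell_le {P : Space d → ℝ} (hP : IsPositiveHomogeneous P)
    {E : Space d →L[ℝ] Space d} (hE : E ∈ exponentSet P) (hc : IsContracting E) {a b M : ℝ}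
    (ha : 0 < a) (hab : a ≤ b) (hM0 : 0 ≤ M) {F : Space d → ℂ}
    (hF : ContinuousOn F {η | P η < b}) (hFi : IntegrableOn F {η | P η < b})
    (hM : ∀ w, 1 ≤ P w → P w < 2 →
      ‖∫ s in (a / P w)..(b / P w), ((s ^ (trE E - 1) : ℝ) : ℂ) * F (tpow s E w)‖ ≤ M) :
    ‖(∫ η in {η | P η < b}, F η) - ∫ η in {η | P η < a}, F η‖ ≤
      M * volume.real {w : Space d | P w ≤ 2} / Real.log 2 := by
  have hPc := hP.continuous
  have hma : MeasurableSet {η | P η < a} := measurableSet_lt hPc.measurable measurable_const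
  have hmb : MeasurableSet {η | P η < b} := measurableSet_lt hPc.measurable measurable_const
  have hsub : {η | P η < a} ⊆ {η | P η < b} := fun η (h : P η < a) => h.trans_le hab
  rw [← setIntegral_sdiff hma hFi hsub, ← integral_indicator (hmb.diff hma)]
  set G := ({η | P η < b} \ {η | P η < a}).indicator F
  have hGm : Measurable G := by
    classical
    have h := (hF.mono Set.sdiff_subset).measurable_piecewise
      (s := {η | P η < b} \ {η | P η < a}) (g := 0) continuousOn_const (hmb.diff hma)
    rwa [Set.piecewise_eq_indicator] at h
  have hGi : Integrable G :=
    (integrable_indicator_iff (hmb.diff hma)).2 (hFi.mono_set Set.sdiff_subset)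
  have key := log_two_smul_integral_eq hPc hE hGm hGi fun η hη =>
    Set.indicator_of_notMem (fun h => h.2 (show P η < a by linarith)) _
  have hin : ∀ w, 1 ≤ P w → P w < 2 → ∫ s in Set.Ioi (0 : ℝ), (s ^ (trE E - 1)) • G (tpow s E w) =
      ∫ s in (a / P w)..(b / P w), ((s ^ (trE E - 1) : ℝ) : ℂ) * F (tpow s E w) := fun w hw _ => by
    have hw0 : 0 < P w := by linarith
    -- As `P(s^E w) = s P(w)`, the orbit of `w` lies in `{a ≤ P < b}` exactly for `s` in `[a / P w,
    -- b / P w)`.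
    have h1 : ∀ s ∈ Set.Ioi (0 : ℝ), (s ^ (trE E - 1)) • G (tpow s E w) =
        (Set.Ico (a / P w) (b / P w)).indicator
          (fun s => ((s ^ (trE E - 1) : ℝ) : ℂ) * F (tpow s E w)) s := fun s hs => by
      simp only [G, Set.indicator_apply, Set.mem_sdiff, Set.mem_ofPred_eq, hE s hs w, Set.mem_Ico,
        div_le_iff₀ hw0, lt_div_iff₀ hw0, not_lt]
      simp only [and_comm (a := a ≤ _)]
      split_ifs
      · rw [Complex.real_smul]
      · rw [smul_zero]
    rw [setIntegral_congr_fun measurableSet_Ioi h1, setIntegral_indicator measurableSet_Ico,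
      Set.inter_eq_right.2 (show Set.Ico (a / P w) (b / P w) ⊆ Set.Ioi 0 from
        fun s hs => (div_pos ha hw0).trans_le hs.1), integral_Ico_eq_integral_Ioc,
      intervalIntegral.integral_of_le (by gcongr)]
  have hW : volume {w | 1 ≤ P w ∧ P w < 2} ≤ volume {w | P w ≤ 2} :=
    measure_mono fun w hw => hw.2.le
  have hfin : volume {w | P w ≤ 2} < ⊤ := (hP.isCompact_le hE hc 2).measure_lt_top
  have hb := norm_setIntegral_le_of_norm_le_const (μ := volume) (hW.trans_lt hfin)
    (fun w (hw : 1 ≤ P w ∧ P w < 2) => (congrArg norm (hin w hw.1 hw.2)).trans_le (hM w hw.1 hw.2))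
  rw [← key, norm_smul, Real.norm_of_nonneg (Real.log_nonneg one_le_two)] at hb
  rw [le_div_iff₀ (Real.log_pos one_lt_two), mul_comm]
  exact hb.trans (mul_le_mul_of_nonneg_left (measureReal_mono (fun w hw => hw.2.le) hfin.ne) hM0)

/-! ### Exponents of a polynomial and of its absolute value -/

/-- If `Q ξ ≠ 0`, then `s ↦ Q(s^E ξ)` is continuous and has no zero on `(0, ∞)`, so it keeps the
sign it has at `s = 1` and the absolute values can be removed. -/
theorem exponentSet_abs {Q : Space d → ℝ} (hQ : Continuous Q) :
    exponentSet Q = exponentSet fun ξ => |Q ξ| := by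
  ext E
  refine ⟨fun h t ht ξ => ?_, fun h t ht ξ => ?_⟩
  · change |Q (tpow t E ξ)| = t * |Q ξ|
    rw [h t ht ξ, abs_mul, abs_of_pos ht]
  · have habs : ∀ s : ℝ, 0 < s → |Q (tpow s E ξ)| = s * |Q ξ| := fun s hs => h s hs ξ
    rcases eq_or_ne (Q ξ) 0 with h0 | h0
    · have := habs t ht
      rw [h0, abs_zero, mul_zero, abs_eq_zero] at this
      rw [this, h0, mul_zero]
    have hc : ContinuousOn (fun s => Q (tpow s E ξ) * Q ξ) (Set.Ioi 0) := fun s hs =>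
      ((hQ.continuousAt.comp (hasDerivAt_tpow_apply hs E ξ).continuousAt).mul
        continuousAt_const).continuousWithinAt
    have hne : ∀ s ∈ Set.Ioi (0 : ℝ), Q (tpow s E ξ) * Q ξ ≠ 0 := fun s hs => by
      refine mul_ne_zero (fun h' => ?_) h0
      have := habs s hs
      rw [h', abs_zero] at this
      exact (mul_pos hs (abs_pos.2 h0)).ne this
    have hpos : 0 < Q (tpow t E ξ) * Q ξ := by
      by_contra hn
      have h1 : (0 : ℝ) ≤ Q (tpow 1 E ξ) * Q ξ := by
        rw [tpow_one]; exact mul_self_nonneg (Q ξ)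
      obtain ⟨s, hs, hs'⟩ := isPreconnected_Ioi.intermediate_value (Set.mem_Ioi.2 ht)
        (Set.mem_Ioi.2 one_pos) hc ⟨not_lt.1 hn, h1⟩
      exact hne s hs hs'
    have h2 := habs t ht
    rcases lt_or_gt_of_ne h0 with h3 | h3
    · have h4 : Q (tpow t E ξ) < 0 := by
        by_contra h'
        nlinarith [not_lt.1 h']
      rw [abs_of_neg h4, abs_of_neg h3] at h2
      linarith
    · have h4 : 0 < Q (tpow t E ξ) := pos_of_mul_pos_left hpos h3.le
      rwa [abs_of_pos h4, abs_of_pos h3] at h2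

/-- Linear maps that preserve a positive homogeneous function are uniformly bounded. -/
theorem IsPositiveHomogeneous.exists_norm_symmetry_le {P : Space d → ℝ}
    (hP : IsPositiveHomogeneous P) {E : Space d →L[ℝ] Space d} (hE : E ∈ exponentSet P)
    (hc : IsContracting E) :
    ∃ C : ℝ, ∀ A : Space d →L[ℝ] Space d, (∀ ξ, P (A ξ) = P ξ) → ‖A‖ ≤ C := by
  obtain ⟨B, hB⟩ := (isCompact_sphere (0 : Space d) 1).bddAbove_image hP.continuous.continuousOn
  obtain ⟨ρ, hρ, hρ'⟩ := (hP.isCompact_le hE hc B).isBounded.exists_pos_norm_le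
  refine ⟨ρ, fun A hA => ContinuousLinearMap.opNorm_le_of_unit_norm hρ.le fun v hv => ?_⟩
  exact hρ' _ (show P (A v) ≤ B from (hA v).trans_le (hB ⟨v, by simpa using hv, rfl⟩))

theorem exists_abs_polyFun_le (Q : MvPolynomial (Fin d) ℝ)
    (hQ : ∀ m : Fin d →₀ ℕ, m.degree ≤ 1 → Q.coeff m = 0) :
    ∃ C : ℝ, ∀ ξ : Space d, ‖ξ‖ ≤ 1 → |polyFun Q ξ| ≤ C * ‖ξ‖ ^ 2 := by
  refine ⟨∑ m ∈ Q.support, |Q.coeff m|, fun ξ hξ => ?_⟩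
  rw [polyFun, MvPolynomial.eval_eq', Finset.sum_mul]
  refine (Finset.abs_sum_le_sum_abs _ _).trans (Finset.sum_le_sum fun m hm => ?_)
  rw [abs_mul]
  refine mul_le_mul_of_nonneg_left ?_ (abs_nonneg _)
  have hdeg : 2 ≤ m.degree := by
    by_contra h
    exact MvPolynomial.mem_support_iff.1 hm (hQ m (by omega))
  calc |∏ i, ξ i ^ m i| = ∏ i, |ξ i| ^ m i := by simp [Finset.abs_prod]
    _ ≤ ∏ i, ‖ξ‖ ^ m i := Finset.prod_le_prod (fun i _ => by positivity) fun i _ =>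
        pow_le_pow_left₀ (abs_nonneg _) (PiLp.norm_apply_le ξ i) _
    _ = ‖ξ‖ ^ m.degree := by rw [Finset.prod_pow_eq_pow_sum, Finsupp.degree_eq_sum]
    _ ≤ ‖ξ‖ ^ 2 := pow_le_pow_of_le_one (norm_nonneg _) hξ hdeg

/-- A positive homogeneous function of second order at the origin has exponents growing at most
like the square root. -/
theorem IsPositiveHomogeneous.exists_norm_tpow_le_sqrt {P : Space d → ℝ}
    (hP : IsPositiveHomogeneous P) {E : Space d →L[ℝ] Space d} (hE : E ∈ exponentSet P)
    (hc : IsContracting E) {C : ℝ} (hC : ∀ ξ, ‖ξ‖ ≤ 1 → P ξ ≤ C * ‖ξ‖ ^ 2) :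
    ∃ ρ : ℝ, 0 < ρ ∧ ∀ t, 1 ≤ t → ‖tpow t E‖ ≤ ρ * √t := by
  obtain ⟨ρ, hρ, hρ'⟩ := (hP.isCompact_le hE hc C).isBounded.exists_pos_norm_le
  refine ⟨ρ, hρ, fun t ht => ContinuousLinearMap.opNorm_le_of_unit_norm (by positivity)
    fun v hv => ?_⟩
  have ht0 : 0 < t := by linarith
  have hs : 0 < √t := Real.sqrt_pos.2 ht0
  have hs1 : 1 ≤ √t := Real.one_le_sqrt.2 ht
  -- Shrinking a unit vector by `√t` makes `P` at most `C/t`; applying `t^E` brings this to at most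
  -- `C`, so the image stays in a fixed compact sublevel set.
  have hn : ‖(√t)⁻¹ • v‖ = (√t)⁻¹ := by
    rw [norm_smul, hv, mul_one, Real.norm_of_nonneg (inv_nonneg.2 hs.le)]
  have h1 := hC ((√t)⁻¹ • v) (by rw [hn]; exact inv_le_one_of_one_le₀ hs1)
  have h2 : P (tpow t E ((√t)⁻¹ • v)) ≤ C := by
    rw [hE t ht0]
    rw [hn, inv_pow, Real.sq_sqrt ht0.le] at h1
    calc t * P ((√t)⁻¹ • v) ≤ t * (C * t⁻¹) := by gcongr
      _ = C := by field_simp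
  have h3 := hρ' _ h2
  rw [map_smul, norm_smul, Real.norm_of_nonneg (inv_nonneg.2 hs.le), inv_mul_le_iff₀ hs] at h3
  linarith

/-! ### Tails of oscillatory integrals -/

/-- A function whose restriction to each orbit `s ↦ s^E w` is `e^{-i (s q + g(s))} B(s)`, with `q`
bounded below and `g`, `B` of slow variation, on the range `a ≤ P < b`. -/
def IsOrbitOscillatory (P : Space d → ℝ) (E : Space d →L[ℝ] Space d) (C a b : ℝ)
    (F : Space d → ℂ) : Prop :=
  ∀ w, 1 ≤ P w → P w < 2 → ∃ (q : ℝ) (g g' g'' B B' : ℝ → ℝ), 1 ≤ |q| ∧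
    ∀ s ∈ Set.Icc (a / P w) (b / P w),
      F (tpow s E w) = Complex.exp (-(Complex.I * (s * q + g s : ℝ))) * B s ∧
      HasDerivAt g (g' s) s ∧ HasDerivAt g' (g'' s) s ∧ HasDerivAt B (B' s) s ∧
      |g' s| ≤ 1 / 4 ∧ |g'' s| ≤ C * s⁻¹ ∧ |B s| ≤ 1 ∧ |B' s| ≤ C * s⁻¹

/-- Along an orbit the linear phase `y · s^E w` has derivative `O(s^{-1/2})`, hence below 1/4 beyond
a threshold. Together with `|q| ≥ 1` and `|g'| ≤ 1/4` the total phase has derivative at least 1/2.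
The constants are chosen before `F`, so they serve the attractor and all rescaled integrands at
once. -/
theorem exists_tail_bound {P : Space d → ℝ} (hP : IsPositiveHomogeneous P)
    {E : Space d →L[ℝ] Space d} (hE : E ∈ exponentSet P) (hc : IsContracting E)
    (hμ : trE E < 1) {ρ : ℝ} (hρ : ∀ t, 1 ≤ t → ‖tpow t E‖ ≤ ρ * √t) {C : ℝ} (hC : 0 ≤ C)
    (r : ℝ) :
    ∃ M a₀ : ℝ, 0 < a₀ ∧ 0 ≤ M ∧ ∀ a b : ℝ, a₀ ≤ a → a ≤ b → ∀ y : Space d, ‖y‖ ≤ r →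
      ∀ F : Space d → ℂ, IsOrbitOscillatory P E C a b F →
      ContinuousOn (fun η => F η * chr (-y) η) {η | P η < b} →
      IntegrableOn (fun η => F η * chr (-y) η) {η | P η < b} →
      ‖(∫ η in {η | P η < b}, F η * chr (-y) η) - ∫ η in {η | P η < a}, F η * chr (-y) η‖ ≤
        M * a ^ (trE E - 1) := by
  obtain ⟨ρ₂, hρ₂, hw⟩ := (hP.isCompact_le hE hc 2).isBounded.exists_pos_norm_le
  set μ := trE E with hμd
  have hρ0 : 0 ≤ ρ := by
    have := (norm_nonneg _).trans (hρ 1 le_rfl)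
    simpa using this
  set r' := max r 0
  have hr0 : 0 ≤ r' := le_max_right _ _
  -- bound for the linear phase
  set D := r' * ‖E‖ * ρ * ρ₂
  have hD : 0 ≤ D := by positivity
  set D₂ := D + r' * ‖E‖ ^ 2 * ρ * ρ₂
  have hD₂ : 0 ≤ D₂ := by positivity
  set C₁ := C + D₂
  set C₂ := C + |μ - 1|
  set M := (4 + (2 * C₂ + 4 * C₁) / (1 - μ))
  have hM : 0 ≤ M := by
    have : 0 < 1 - μ := by linarith
    positivity
  -- On the shell `P w < 2`, so the threshold on `a` ensures `s ≥ 1 + (4D)²` along the orbit, hence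
  -- `s ≥ 1` and `√s ≥ 4D`. The factor `(1/2)^{μ-1}` pays for the lower limit `a / P w` in place of
  -- `a`.
  refine ⟨M * (1 / 2) ^ (μ - 1) * volume.real {w : Space d | P w ≤ 2} / Real.log 2,
    2 * (1 + (4 * D) ^ 2), by positivity,
    by have := Real.log_pos one_lt_two; positivity, ?_⟩
  intro a b ha hab y hy F hosc hFc' hFi'
  have ha0 : 0 < a := lt_of_lt_of_le (by positivity) ha
  have hb := norm_setIntegral_shell_le (M := M * (1 / 2) ^ (μ - 1) * a ^ (μ - 1)) hP hE hc ha0 hab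
    (by positivity) hFc' hFi' ?_
  · refine hb.trans (le_of_eq ?_)
    ring
  intro w hw1 hw2
  have hw0 : 0 < P w := by linarith
  obtain ⟨q, g, g', g'', B, B', hq, hall⟩ := hosc w hw1 hw2
  have hlow : ∀ s ∈ Set.Icc (a / P w) (b / P w), 1 + (4 * D) ^ 2 ≤ s := fun s hs => by
    refine le_trans ?_ hs.1
    rw [le_div_iff₀ hw0]
    nlinarith [sq_nonneg (4 * D)]
  have hpos : ∀ s ∈ Set.Icc (a / P w) (b / P w), 0 < s := fun s hs =>
    (div_pos ha0 hw0).trans_le hs.1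
  have hone : ∀ s ∈ Set.Icc (a / P w) (b / P w), 1 ≤ s := fun s hs => by
    have := hlow s hs; nlinarith [sq_nonneg (4 * D)]
  have hsq : ∀ s ∈ Set.Icc (a / P w) (b / P w), 4 * D ≤ √s := fun s hs =>
    Real.le_sqrt_of_sq_le (by have := hlow s hs; linarith)
  have hy' : ‖y‖ ≤ r' := hy.trans (le_max_left _ _)
  have hsw : ∀ s ∈ Set.Icc (a / P w) (b / P w), ‖tpow s E w‖ ≤ ρ * √s * ρ₂ := fun s hs =>
    ((tpow s E).le_opNorm w).trans (mul_le_mul (hρ s (hone s hs)) (hw w hw2.le) (norm_nonneg _)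
      (by positivity))
  -- the linear phase along the orbit
  let l : ℝ → ℝ := fun s => inner ℝ y (tpow s E w)
  let l' : ℝ → ℝ := fun s => s⁻¹ * inner ℝ y (E (tpow s E w))
  let l'' : ℝ → ℝ := fun s => -(s ^ 2)⁻¹ * inner ℝ y (E (tpow s E w)) +
    s⁻¹ * (s⁻¹ * inner ℝ y (E (E (tpow s E w))))
  have hl : ∀ s, 0 < s → HasDerivAt l (l' s) s := fun s hs => by
    refine ((hasDerivAt_const s y).inner ℝ (hasDerivAt_tpow_apply hs E w)).congr_deriv ?_
    simp [l', inner_smul_right]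
  have hl' : ∀ s, 0 < s → HasDerivAt l' (l'' s) s := fun s hs => by
    have h1 : HasDerivAt (fun s => E (tpow s E w)) (E (s⁻¹ • E (tpow s E w))) s :=
      E.hasFDerivAt.comp_hasDerivAt s (hasDerivAt_tpow_apply hs E w)
    refine ((hasDerivAt_inv hs.ne').mul ((hasDerivAt_const s y).inner ℝ h1)).congr_deriv ?_
    simp [l'', inner_smul_right]
  have hi1 : ∀ s ∈ Set.Icc (a / P w) (b / P w), |inner ℝ y (E (tpow s E w))| ≤ D * √s :=
    fun s hs => by
    refine (abs_real_inner_le_norm _ _).trans ?_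
    calc ‖y‖ * ‖E (tpow s E w)‖ ≤ r' * (‖E‖ * (ρ * √s * ρ₂)) :=
          mul_le_mul hy' ((E.le_opNorm _).trans (by gcongr; exact hsw s hs)) (norm_nonneg _) hr0
      _ = D * √s := by simp only [D]; ring
  have hi2 : ∀ s ∈ Set.Icc (a / P w) (b / P w), |inner ℝ y (E (E (tpow s E w)))| ≤
      r' * ‖E‖ ^ 2 * ρ * ρ₂ * √s := fun s hs => by
    refine (abs_real_inner_le_norm _ _).trans ?_
    have h2 : ‖E (E (tpow s E w))‖ ≤ ‖E‖ * (‖E‖ * (ρ * √s * ρ₂)) :=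
      (E.le_opNorm _).trans (by gcongr; exact (E.le_opNorm _).trans (by gcongr; exact hsw s hs))
    calc ‖y‖ * ‖E (E (tpow s E w))‖ ≤ r' * (‖E‖ * (‖E‖ * (ρ * √s * ρ₂))) :=
          mul_le_mul hy' h2 (norm_nonneg _) hr0
      _ = _ := by ring
  have hl1 : ∀ s ∈ Set.Icc (a / P w) (b / P w), |l' s| ≤ 1 / 4 := fun s hs => by
    have hs0 := hpos s hs
    simp only [l']
    rw [abs_mul, abs_of_pos (inv_pos.2 hs0), inv_mul_le_iff₀ hs0]
    have h1 := hi1 s hs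
    have h2 := hsq s hs
    have h3 := Real.mul_self_sqrt hs0.le
    nlinarith [Real.sqrt_nonneg s]
  have hl2 : ∀ s ∈ Set.Icc (a / P w) (b / P w), |l'' s| ≤ D₂ * s⁻¹ := fun s hs => by
    have hs0 := hpos s hs
    have h3 : √s ≤ s := by
      have := Real.mul_self_sqrt hs0.le
      have := Real.one_le_sqrt.2 (hone s hs)
      nlinarith
    simp only [l'']
    refine (abs_add_le _ _).trans ?_
    rw [abs_mul, abs_mul, abs_mul, abs_neg, abs_of_pos (inv_pos.2 hs0),
      abs_of_pos (inv_pos.2 (pow_pos hs0 2))]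
    have e1 : (s ^ 2)⁻¹ * |inner ℝ y (E (tpow s E w))| ≤ (s ^ 2)⁻¹ * (D * s) := by
      gcongr; exact (hi1 s hs).trans (by gcongr)
    have e2 : s⁻¹ * (s⁻¹ * |inner ℝ y (E (E (tpow s E w)))|) ≤
        s⁻¹ * (s⁻¹ * (r' * ‖E‖ ^ 2 * ρ * ρ₂ * s)) := by
      gcongr; exact (hi2 s hs).trans (by gcongr)
    have e3 : (s ^ 2)⁻¹ * (D * s) + s⁻¹ * (s⁻¹ * (r' * ‖E‖ ^ 2 * ρ * ρ₂ * s)) = D₂ * s⁻¹ := by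
      simp only [D₂]; field_simp
    linarith
  have hfin := norm_integral_oscillatory_le (a := a / P w) (b := b / P w) (C₁ := C₁) (C₂ := C₂) hμ
    (div_pos ha0 hw0) (by gcongr) (f := fun s => s * q + g s + l s) (f' := fun s => q + g' s + l' s)
    (f'' := fun s => g'' s + l'' s) (A := fun s => s ^ (μ - 1) * B s)
    (A' := fun s => (μ - 1) * s ^ (μ - 2) * B s + s ^ (μ - 1) * B' s) ?_ ?_ ?_ ?_ ?_ ?_ ?_
  · refine le_trans (le_of_eq ?_) (hfin.trans ?_)
    · congr 1
      refine intervalIntegral.integral_congr fun s hs => ?_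
      rw [Set.uIcc_of_le (by gcongr)] at hs
      rw [(hall s hs).1, chr_neg_left]
      have : Complex.exp (-(Complex.I * ((s * q + g s + l s : ℝ) : ℂ))) =
          Complex.exp (-(Complex.I * ((s * q + g s : ℝ) : ℂ))) *
            Complex.exp (-(Complex.I * (inner ℝ y (tpow s E w) : ℝ))) := by
        rw [← Complex.exp_add]
        simp only [l]
        congr 1; push_cast; ring
      rw [this]
      push_cast
      ring
    · have h1 : (a / P w) ^ (μ - 1) ≤ (1 / 2) ^ (μ - 1) * a ^ (μ - 1) := by
        rw [← Real.mul_rpow (by norm_num) ha0.le]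
        refine Real.rpow_le_rpow_of_nonpos (by positivity) ?_ (by linarith)
        rw [le_div_iff₀ hw0]; nlinarith
      calc M * (a / P w) ^ (μ - 1) ≤ M * ((1 / 2) ^ (μ - 1) * a ^ (μ - 1)) := by gcongr
        _ = _ := by ring
  · intro s hs
    exact ((((hasDerivAt_id s).mul_const q).add (hall s hs).2.1).add (hl s (hpos s hs))).congr_deriv
      (by simp)
  · intro s hs
    exact ((((hall s hs).2.2.1).const_add q).add (hl' s (hpos s hs)))
  · intro s hs
    have := (Real.hasDerivAt_rpow_const (p := μ - 1) (Or.inl (hpos s hs).ne')).mul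
      (hall s hs).2.2.2.1
    rwa [show μ - 1 - 1 = μ - 2 by ring] at this
  · intro s hs
    have h1 := abs_le.1 (hall s hs).2.2.2.2.1
    have h2 := abs_le.1 (hl1 s hs)
    rcases le_abs.1 hq with h | h
    · exact le_abs.2 (Or.inl (by linarith))
    · exact le_abs.2 (Or.inr (by linarith))
  · intro s hs
    refine (abs_add_le _ _).trans ?_
    have := (hall s hs).2.2.2.2.2.1
    have := hl2 s hs
    simp only [C₁]
    linarith
  · intro s hs
    rw [abs_mul, abs_of_pos (Real.rpow_pos_of_pos (hpos s hs) _)]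
    exact mul_le_of_le_one_right (Real.rpow_nonneg (hpos s hs).le _) (hall s hs).2.2.2.2.2.2.1
  · intro s hs
    have hs0 := hpos s hs
    refine (abs_add_le _ _).trans ?_
    have h1 := (hall s hs).2.2.2.2.2.2.1
    have h2 := (hall s hs).2.2.2.2.2.2.2
    rw [abs_mul, abs_mul, abs_mul, abs_of_pos (Real.rpow_pos_of_pos hs0 (μ - 2)),
      abs_of_pos (Real.rpow_pos_of_pos hs0 (μ - 1))]
    have e1 : |μ - 1| * s ^ (μ - 2) * |B s| ≤ |μ - 1| * s ^ (μ - 2) :=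
      mul_le_of_le_one_right (by positivity) h1
    have e2 : s ^ (μ - 1) * |B' s| ≤ s ^ (μ - 1) * (C * s⁻¹) := by gcongr
    have e3 : s ^ (μ - 1) * (C * s⁻¹) = C * s ^ (μ - 2) := by
      rw [show μ - 2 = μ - 1 - 1 by ring, Real.rpow_sub_one hs0.ne' (μ - 1)]; ring
    simp only [C₂]
    linarith

/-! ### Orbit estimates for strongly subhomogeneous functions -/

/-- Orbits are smooth in `s > 0`, so restriction to an orbit loses no derivatives; this gives
genuine derivatives behind the iterated ones in strong subhomogeneity. -/
theorem contDiffOn_comp_tpow {U : Set (Space d)} (hU : IsOpen U) {f : Space d → ℝ} {l : ℕ}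
    (hf : ContDiffOn ℝ l f U) (E : Space d →L[ℝ] Space d) (w : Space d) {τ : ℝ}
    (h : ∀ s, 0 < s → s < τ → tpow s E w ∈ U) :
    ContDiffOn ℝ l (fun s => f (tpow s E w)) (Set.Ioo 0 τ) := fun s hs => by
  have h1 : ContDiffAt ℝ l f (tpow s E w) := hf.contDiffAt (hU.mem_nhds (h s hs.1 hs.2))
  have h2 : ContDiffAt ℝ l (fun s => tpow s E w) s := by
    have h3 : ContDiffAt ℝ l (NormedSpace.exp : (Space d →L[ℝ] Space d) → _) (Real.log s • E) :=
      (NormedSpace.exp_analytic (𝕂 := ℝ) (Real.log s • E)).contDiffAt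
    have h4 : ContDiffAt ℝ l (fun s => Real.log s • E) s :=
      (Real.contDiffAt_log.2 hs.1.ne').smul contDiffAt_const
    exact (h3.comp s h4).clm_apply contDiffAt_const
  exact (h1.comp s h2).contDiffWithinAt

theorem hasDerivAt_iteratedDeriv_succ {h : ℝ → ℝ} {s : Set ℝ} (hs : IsOpen s) {l k : ℕ}
    (hh : ContDiffOn ℝ l h s) (hk : k < l) {x : ℝ} (hx : x ∈ s) :
    HasDerivAt (iteratedDeriv k h) (iteratedDeriv (k + 1) h x) x := by
  have h1 : DifferentiableAt ℝ (iteratedDeriv k h) x :=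
    ((hh.differentiableOn_iteratedDerivWithin (by exact_mod_cast hk) hs.uniqueDiffOn).congr
      fun y hy => (iteratedDerivWithin_of_isOpen hs hy).symm).differentiableAt (hs.mem_nhds hx)
  rw [iteratedDeriv_succ]
  exact h1.hasDerivAt

theorem IsStronglySubhomogeneous.exists_orbit_bounds {U : Set (Space d)} (hU : IsOpen U)
    {f : Space d → ℝ} {E : Space d →L[ℝ] Space d} {l : ℕ} (hf : IsStronglySubhomogeneous U f E l)
    {K : Set (Space d)} (hK : IsCompact K) {ε : ℝ} (hε : 0 < ε) :
    ∃ τ : ℝ, 0 < τ ∧ ∀ w ∈ K, ∀ s, 0 < s → s < τ →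
      (∀ k < l, HasDerivAt (iteratedDeriv k fun s => f (tpow s E w))
        (iteratedDeriv (k + 1) (fun s => f (tpow s E w)) s) s) ∧
      ∀ k ≤ l, |iteratedDeriv k (fun s => f (tpow s E w)) s| ≤ ε * s / s ^ k := by
  obtain ⟨τ, hτ, h⟩ := hf.2.2 ε hε K hK
  refine ⟨τ, hτ, fun w hw s hs hsτ => ⟨fun k hk => ?_, fun k hk => ?_⟩⟩
  · exact hasDerivAt_iteratedDeriv_succ isOpen_Ioo (contDiffOn_comp_tpow hU hf.2.1 E w
      fun t ht1 ht2 => (h t ht1 ht2 w hw).1) hk ⟨hs, hsτ⟩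
  · have := (h s hs hsτ w hw).2 k hk
    rw [abs_mul, abs_of_pos (pow_pos hs k)] at this
    rwa [le_div_iff₀ (pow_pos hs k), mul_comm]

/-! ### Points of imaginary homogeneous type -/

theorem isOrbitOscillatory_exp {Q : Space d → ℝ} {E : Space d →L[ℝ] Space d}
    (hE : E ∈ exponentSet Q) {C : ℝ} (hC : 0 ≤ C) {a : ℝ} (ha : 0 < a) (b : ℝ) :
    IsOrbitOscillatory (fun ξ => |Q ξ|) E C a b fun η => Complex.exp (-(Complex.I * Q η)) := by
  intro w hw1 hw2
  refine ⟨Q w, fun _ => 0, fun _ => 0, fun _ => 0, fun _ => 1, fun _ => 0, hw1, fun s hs => ?_⟩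
  have hs0 : 0 < s := (div_pos ha (by linarith)).trans_le hs.1
  refine ⟨?_, hasDerivAt_const _ _, hasDerivAt_const _ _, hasDerivAt_const _ _, ?_, ?_, ?_, ?_⟩
  · simp [hE s hs0 w]
  · simp
  · rw [abs_zero]; positivity
  · simp
  · rw [abs_zero]; positivity

theorem tpow_eq_tpow_inv_smul {k : ℝ} (hk : 0 < k) {s : ℝ} (hs : 0 < s)
    (E : Space d →L[ℝ] Space d) : tpow s E = tpow (s ^ k) (k⁻¹ • E) := by
  rw [tpow_smul (Real.rpow_pos_of_pos hs _), ← Real.rpow_mul hs.le, mul_inv_cancel₀ hk.ne',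
    Real.rpow_one]

theorem mul_exp_neg_mul_le {c x : ℝ} (hc : 0 < c) : x * Real.exp (-(c * x)) ≤ c⁻¹ := by
  have h := Real.add_one_le_exp (c * x)
  rw [Real.exp_neg, ← div_eq_mul_inv, div_le_iff₀ (Real.exp_pos _), inv_mul_eq_div,
    le_div_iff₀ hc]
  linarith

namespace GammaExpansion

variable {φ : IntLattice d → ℂ} {ξ₀ : Space d} {e : GammaExpansion φ ξ₀}

/-- With `σ = s/n` and `u = σ^k`, the orbit phase is `s Q(w) + n Q̃(σ^E w)` and the amplitude is
`exp(-n(u R(w) + R̃(u^{E/k} w)))`. The chain rule cancels `n` in the first phase derivative and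
turns the second into `O(1/s)`. Differentiating the amplitude costs a factor of order `nu/s`,
absorbed by its decay `exp(-c n u / 2)`. No constant depends on `n`. -/
theorem exists_isOrbitOscillatory {E : Space d →L[ℝ] Space d}
    (hQ : IsPositiveHomogeneous fun ξ => |polyFun e.Q ξ|)
    (hR : IsPositiveHomogeneous (polyFun e.R))
    (hE : E ∈ exponentSet (polyFun e.Q)) (hc : IsContracting E) {k : ℝ} (hk : 1 < k)
    (hER : k⁻¹ • E ∈ exponentSet (polyFun e.R))
    (hsQ : IsStronglySubhomogeneous e.U e.Qt E 2)
    (hsR : IsStronglySubhomogeneous e.U e.Rt (k⁻¹ • E) 1) :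
    ∃ C δ₀ : ℝ, 0 ≤ C ∧ 0 < δ₀ ∧ ∀ n : ℕ, 0 < n → ∀ a b : ℝ, 0 < a → b < n * δ₀ →
      IsOrbitOscillatory (fun ξ => |polyFun e.Q ξ|) E C a b
        fun η => Complex.exp (-(n * e.phase (tpow (n : ℝ)⁻¹ E η))) := by
  have hk0 : 0 < k := by linarith
  have hE' : E ∈ exponentSet fun ξ => |polyFun e.Q ξ| :=
    exponentSet_abs (continuous_polyFun e.Q) ▸ hE
  have hK₂ := hQ.isCompact_le hE' hc 2
  set K : Set (Space d) := {w | 1 ≤ |polyFun e.Q w| ∧ |polyFun e.Q w| ≤ 2}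
  have hK : IsCompact K := hK₂.inter_left (isClosed_le continuous_const hQ.continuous)
  obtain ⟨c, CR, hc0, hcR⟩ : ∃ c CR : ℝ, 0 < c ∧
      ∀ w ∈ K, c ≤ polyFun e.R w ∧ polyFun e.R w ≤ CR := by
    rcases K.eq_empty_or_nonempty with h | h
    · exact ⟨1, 1, one_pos, fun w hw => by rw [h] at hw; exact hw.elim⟩
    obtain ⟨x, hx, hmin⟩ := hK.exists_isMinOn h hR.continuous.continuousOn
    obtain ⟨z, hz, hmax⟩ := hK.exists_isMaxOn h hR.continuous.continuousOn
    refine ⟨_, _, hR.pos fun h0 => ?_, fun w hw => ⟨hmin hw, hmax hw⟩⟩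
    have h1 : 1 ≤ |polyFun e.Q x| := hx.1
    rw [h0, show |polyFun e.Q 0| = 0 from hQ.map_zero] at h1
    linarith
  obtain ⟨τ₁, hτ₁, hb₁⟩ := hsQ.exists_orbit_bounds e.isOpen_U hK (ε := 1 / 4) (by norm_num)
  obtain ⟨τ₂, hτ₂, hb₂⟩ := hsR.exists_orbit_bounds e.isOpen_U hK (half_pos hc0)
  -- The factors come from the bound on `x e^{-cx/2}`, from the bound on `R(w)` plus the derivative
  -- of the remainder, and from differentiating `σ^k`.
  set CB := (c / 2)⁻¹ * (|CR| + c / 2) * k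
  refine ⟨1 / 4 + CB, min τ₁ (τ₂ ^ k⁻¹), by positivity,
    lt_min hτ₁ (Real.rpow_pos_of_pos hτ₂ _), fun n hn a b ha hb w hw1 hw2 => ?_⟩
  have hn' : (0 : ℝ) < n := by exact_mod_cast hn
  have hw : w ∈ K := ⟨hw1, hw2.le⟩
  let h : ℝ → ℝ := fun s => e.Qt (tpow s E w)
  let r : ℝ → ℝ := fun u => e.Rt (tpow u (k⁻¹ • E) w)
  refine ⟨polyFun e.Q w, fun s => n * h (s / n), fun s => iteratedDeriv 1 h (s / n),
    fun s => iteratedDeriv 2 h (s / n) / n,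
    fun s => Real.exp (-(n * ((s / n) ^ k * polyFun e.R w + r ((s / n) ^ k)))),
    fun s => Real.exp (-(n * ((s / n) ^ k * polyFun e.R w + r ((s / n) ^ k)))) *
      -(n * ((k * (s / n) ^ (k - 1) * (1 / n)) *
        (polyFun e.R w + iteratedDeriv 1 r ((s / n) ^ k)))), hw1, fun s hs => ?_⟩
  have hw0 : 0 < |polyFun e.Q w| := by linarith
  have hs0 : 0 < s := (div_pos ha hw0).trans_le hs.1
  set σ := s / n with hσ
  have hσ0 : 0 < σ := div_pos hs0 hn'
  have hσδ : σ < min τ₁ (τ₂ ^ k⁻¹) := by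
    rw [hσ, div_lt_iff₀ hn', mul_comm]
    refine lt_of_le_of_lt (hs.2.trans ?_) hb
    have hb0 : 0 ≤ b := by
      have := hs0.le.trans hs.2
      rw [le_div_iff₀ hw0, zero_mul] at this
      exact this
    exact div_le_self hb0 hw1
  have hσ1 : σ < τ₁ := hσδ.trans_le (min_le_left _ _)
  set u := σ ^ k with hu
  have hu0 : 0 < u := Real.rpow_pos_of_pos hσ0 _
  have hu2 : u < τ₂ := by
    have := Real.rpow_lt_rpow hσ0.le (hσδ.trans_le (min_le_right _ _)) hk0
    rwa [← Real.rpow_mul hτ₂.le, inv_mul_cancel₀ hk0.ne', Real.rpow_one] at this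
  obtain ⟨hd₁, he₁⟩ := hb₁ w hw σ hσ0 hσ1
  obtain ⟨hd₂, he₂⟩ := hb₂ w hw u hu0 hu2
  have hdiv : HasDerivAt (fun s : ℝ => s / n) (1 / n) s := (hasDerivAt_id s).div_const _
  have hh0 : HasDerivAt h (iteratedDeriv 1 h σ) σ := by
    have := hd₁ 0 (by norm_num); rwa [iteratedDeriv_zero] at this
  have hh1 : HasDerivAt (iteratedDeriv 1 h) (iteratedDeriv 2 h σ) σ := hd₁ 1 (by norm_num)
  have hr0 : HasDerivAt r (iteratedDeriv 1 r u) u := by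
    have := hd₂ 0 (by norm_num); rwa [iteratedDeriv_zero] at this
  have hb1 : |iteratedDeriv 1 h σ| ≤ 1 / 4 := by
    have := he₁ 1 (by norm_num)
    rwa [pow_one, mul_div_assoc, div_self hσ0.ne', mul_one] at this
  have hb2 : |iteratedDeriv 2 h σ| ≤ 1 / 4 * σ⁻¹ := by
    refine (he₁ 2 le_rfl).trans (le_of_eq ?_)
    field_simp
  have hbr : |r u| ≤ c / 2 * u := by
    have := he₂ 0 (by norm_num)
    rwa [iteratedDeriv_zero, pow_zero, div_one] at this
  have hbr1 : |iteratedDeriv 1 r u| ≤ c / 2 := by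
    have := he₂ 1 le_rfl
    rwa [pow_one, mul_div_assoc, div_self hu0.ne', mul_one] at this
  obtain ⟨hRc, hRC⟩ := hcR w hw
  have hBexp : Real.exp (-(n * (u * polyFun e.R w + r u))) ≤ Real.exp (-(c / 2 * (n * u))) := by
    rw [Real.exp_le_exp, neg_le_neg_iff]
    have := (abs_le.1 hbr).1
    have h2 : u * c ≤ u * polyFun e.R w := by gcongr
    nlinarith
  have hCB : 0 ≤ CB := by positivity
  refine ⟨?_, ?_, ?_, ?_, hb1, ?_, ?_, ?_⟩
  · have e1 : tpow (n : ℝ)⁻¹ E (tpow s E w) = tpow σ E w := by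
      rw [← tpow_mul_apply (inv_pos.2 hn') hs0, inv_mul_eq_div]
    have e2 : tpow σ E = tpow u (k⁻¹ • E) := tpow_eq_tpow_inv_smul hk0 hσ0 E
    have e3 : polyFun e.R (tpow σ E w) = u * polyFun e.R w := by rw [e2, hER u hu0]
    have e4 : e.Rt (tpow σ E w) = r u := by rw [e2]
    beta_reduce
    rw [e1, phase, hE σ hσ0, e3, e4, Complex.ofReal_exp, ← Complex.exp_add]
    congr 1
    have hnc : (n : ℂ) ≠ 0 := by exact_mod_cast hn.ne'
    simp only [hσ, h]
    push_cast
    field_simp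
    ring
  · refine ((HasDerivAt.comp (h := fun s : ℝ => s / n) s hh0 hdiv).const_mul (n : ℝ)).congr_deriv ?_
    change _ = iteratedDeriv 1 h σ
    field_simp
  · refine (HasDerivAt.comp (h := fun s : ℝ => s / n) s hh1 hdiv).congr_deriv ?_
    rw [mul_one_div]
  · have hpow : HasDerivAt (fun s : ℝ => (s / n) ^ k) (k * σ ^ (k - 1) * (1 / n)) s :=
      (hdiv.rpow_const (Or.inl hσ0.ne')).congr_deriv (by ring)
    have := (((hpow.mul_const (polyFun e.R w)).add
      (HasDerivAt.comp (h := fun s : ℝ => (s / n) ^ k) s hr0 hpow)).const_mul (n : ℝ)).neg.exp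
    refine this.congr_deriv ?_
    simp only [Pi.add_apply, Function.comp_apply, Pi.neg_apply]
    ring
  · rw [abs_div, abs_of_pos hn', div_le_iff₀ hn']
    have e1 : (1 / 4 + CB) * s⁻¹ * n = (1 / 4 + CB) * σ⁻¹ := by
      rw [hσ]; field_simp
    rw [e1]
    refine hb2.trans ?_
    gcongr
    linarith
  · rw [abs_of_pos (Real.exp_pos _)]
    refine hBexp.trans (Real.exp_le_one_iff.2 ?_)
    have : 0 ≤ c / 2 * (n * u) := by positivity
    linarith
  -- This identity extracts the decay `1/s` from the chain rule and leaves the product `nu` for the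
  -- exponential to absorb.
  · have e1 : σ ^ (k - 1) * (1 / n) = u * s⁻¹ := by
      rw [Real.rpow_sub_one hσ0.ne', hu, hσ]; field_simp
    have e2 : |polyFun e.R w + iteratedDeriv 1 r u| ≤ |CR| + c / 2 := by
      refine (abs_add_le _ _).trans (add_le_add ?_ hbr1)
      rw [abs_of_pos (hc0.trans_le hRc)]
      exact hRC.trans (le_abs_self _)
    have e3 : (n * u) * Real.exp (-(n * (u * polyFun e.R w + r u))) ≤ (c / 2)⁻¹ :=
      (mul_le_mul_of_nonneg_left hBexp (by positivity)).trans (mul_exp_neg_mul_le (half_pos hc0))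
    simp only [← hσ, ← hu]
    rw [mul_assoc k, e1, abs_mul, abs_neg, abs_mul, abs_mul, abs_of_pos (Real.exp_pos _),
      abs_of_pos hn', abs_of_pos (show 0 < k * (u * s⁻¹) by positivity)]
    calc Real.exp (-(n * (u * polyFun e.R w + r u))) * (n * (k * (u * s⁻¹) *
          |polyFun e.R w + iteratedDeriv 1 r u|))
        = ((n * u) * Real.exp (-(n * (u * polyFun e.R w + r u)))) *
          |polyFun e.R w + iteratedDeriv 1 r u| * k * s⁻¹ := by ring
      _ ≤ (c / 2)⁻¹ * (|CR| + c / 2) * k * s⁻¹ := by gcongr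
      _ ≤ (1 / 4 + CB) * s⁻¹ := by gcongr; simp only [CB]; linarith

end GammaExpansion

/-! ### Existence of the oscillatory attractor -/

/-- The integrand of the oscillatory attractor. -/
def oscIntegrand (Q : Space d → ℝ) (t : ℝ) (x : Space d) : Space d → ℂ :=
  attractorIntegrand (fun ξ => Complex.I * (Q ξ : ℂ)) t x

theorem oscIntegrand_one (Q : Space d → ℝ) (y : Space d) :
    oscIntegrand Q 1 y = fun η => Complex.exp (-(Complex.I * Q η)) * chr (-y) η := by
  funext η
  rw [oscIntegrand, attractorIntegrand_eq, Complex.ofReal_one, one_mul]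

theorem continuous_oscIntegrand {Q : Space d → ℝ} (hQ : Continuous Q) (t : ℝ) (x : Space d) :
    Continuous (oscIntegrand Q t x) :=
  continuous_attractorIntegrand (by fun_prop) t x

theorem tendsto_const_mul_rpow_sub_one {μ : ℝ} (hμ : μ < 1) (M : ℝ) :
    Tendsto (fun a : ℝ => M * a ^ (μ - 1)) atTop (𝓝 0) := by
  have := (tendsto_rpow_neg_atTop (y := 1 - μ) (by linarith)).const_mul M
  rw [mul_zero] at this
  refine this.congr fun a => ?_
  rw [neg_sub]

section osc

variable {Q : Space d → ℝ} (hP : IsPositiveHomogeneous fun ξ => |Q ξ|) (hQ : Continuous Q)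
  {E : Space d →L[ℝ] Space d} (hE : E ∈ exponentSet Q) (hc : IsContracting E)
  (hμ : trE E < 1) {ρ : ℝ} (hρ : ∀ t, 1 ≤ t → ‖tpow t E‖ ≤ ρ * √t)

include hP hQ hE hc hμ hρ

theorem exists_oscIntegrand_tail_bound (r : ℝ) :
    ∃ M a₀ : ℝ, 0 < a₀ ∧ 0 ≤ M ∧ ∀ a b : ℝ, a₀ ≤ a → a ≤ b → ∀ y : Space d, ‖y‖ ≤ r →
      ‖(∫ η in sublevel Q b, oscIntegrand Q 1 y η) - ∫ η in sublevel Q a, oscIntegrand Q 1 y η‖ ≤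
        M * a ^ (trE E - 1) := by
  have hE' : E ∈ exponentSet fun ξ => |Q ξ| := exponentSet_abs hQ ▸ hE
  obtain ⟨M, a₀, ha₀, hM, h⟩ := exists_tail_bound hP hE' hc hμ hρ le_rfl r
  refine ⟨M, a₀, ha₀, hM, fun a b ha hab y hy => ?_⟩
  have hcont := continuous_oscIntegrand hQ 1 y
  have hint : IntegrableOn (oscIntegrand Q 1 y) {η | |Q η| < b} :=
    (hcont.continuousOn.integrableOn_compact (hP.isCompact_le hE' hc b)).mono_set
      fun η (hη : |Q η| < b) => hη.le
  rw [oscIntegrand_one] at hcont hint ⊢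
  exact h a b ha hab y hy _ (isOrbitOscillatory_exp hE le_rfl (ha₀.trans_le ha) b)
    hcont.continuousOn hint

/-- The truncated integrals form a Cauchy family, because the tail bound `M a^{μ-1}` tends to 0. -/
theorem exists_hasRenormIntegral_one (y : Space d) :
    ∃ L : ℂ, HasRenormIntegral (sublevel Q) (oscIntegrand Q 1 y) L := by
  obtain ⟨M, a₀, ha₀, hM, h⟩ := exists_oscIntegrand_tail_bound hP hQ hE hc hμ hρ ‖y‖
  refine cauchySeq_tendsto_of_complete (Metric.cauchySeq_iff'.2 fun ε hε => ?_)
  obtain ⟨a, ha, ha'⟩ := (((tendsto_const_mul_rpow_sub_one hμ M).eventually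
    (Iio_mem_nhds hε)).and (eventually_ge_atTop a₀)).exists
  exact ⟨a, fun b hb => (dist_eq_norm _ _).trans_lt ((h a b ha' hb y le_rfl).trans_lt ha)⟩

omit hP hQ hc hμ hρ in
-- Substitution maps the approximating family to itself, replacing the cutoff `τ` by `τt`, so the
-- limit at time 1 transfers to every `t > 0`.
theorem HasRenormIntegral.rescale {t : ℝ} (ht : 0 < t) {x : Space d} {L : ℂ}
    (h : HasRenormIntegral (sublevel Q)
      (oscIntegrand Q 1 (ContinuousLinearMap.adjoint (tpow t⁻¹ E) x)) L) :
    HasRenormIntegral (sublevel Q) (oscIntegrand Q t x) (((t ^ trE E : ℝ) : ℂ)⁻¹ * L) := by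
  have hE' : E ∈ exponentSet fun ξ => |Q ξ| := fun s hs ξ => by
    change |Q (tpow s E ξ)| = s * |Q ξ|
    rw [hE s hs ξ, abs_mul, abs_of_pos hs]
  have h1 := (h.comp (tendsto_id.atTop_mul_const ht)).const_mul (((t ^ trE E : ℝ) : ℂ)⁻¹)
  refine h1.congr fun τ => ?_
  have h2 := setIntegral_attractorIntegrand (P := fun ξ => Complex.I * (Q ξ : ℂ)) (E := E)
    (fun s hs ξ => by rw [hE s hs]; push_cast; ring) ht x (sublevel Q τ)
  have h3 : tpow t⁻¹ E ⁻¹' sublevel Q τ = sublevel Q (τ * t) := by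
    have := preimage_tpow_sublevel hE' (inv_pos.2 ht) τ
    rwa [div_inv_eq_mul] at this
  have h4 : ((t ^ trE E : ℝ) : ℂ) ≠ 0 := by exact_mod_cast (Real.rpow_pos_of_pos ht _).ne'
  rw [h3] at h2
  simp only [Function.comp_apply, id]
  rw [inv_mul_eq_iff_eq_mul₀ h4]
  exact h2.symm

theorem exists_hasRenormIntegral {t : ℝ} (ht : 0 < t) (x : Space d) :
    ∃ L : ℂ, HasRenormIntegral (sublevel Q) (oscIntegrand Q t x) L :=
  let ⟨_, hL⟩ := exists_hasRenormIntegral_one hP hQ hE hc hμ hρ _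
  ⟨_, hL.rescale hE ht⟩

/-- The rescaled attractor is well approximated by integrals over large sublevel sets. -/
theorem exists_oscAttractor_approx (r : ℝ) :
    ∃ M a₀ : ℝ, 0 < a₀ ∧ 0 ≤ M ∧ ∀ a : ℝ, a₀ ≤ a → ∀ t : ℝ, 0 < t → ∀ x : Space d,
      ‖ContinuousLinearMap.adjoint (tpow t⁻¹ E) x‖ ≤ r →
      ‖(2 * (Real.pi : ℂ)) ^ d * ((t ^ trE E : ℝ) : ℂ) * oscAttractor Q t x -
        ∫ η in sublevel Q a, oscIntegrand Q 1 (ContinuousLinearMap.adjoint (tpow t⁻¹ E) x) η‖ ≤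
        M * a ^ (trE E - 1) := by
  obtain ⟨M, a₀, ha₀, hM, h⟩ := exists_oscIntegrand_tail_bound hP hQ hE hc hμ hρ r
  refine ⟨M, a₀, ha₀, hM, fun a ha t ht x hx => ?_⟩
  obtain ⟨L, hL⟩ := exists_hasRenormIntegral_one hP hQ hE hc hμ hρ
    (ContinuousLinearMap.adjoint (tpow t⁻¹ E) x)
  have hpi : ((2 * (Real.pi : ℂ)) ^ d) ≠ 0 :=
    pow_ne_zero _ (mul_ne_zero two_ne_zero (by exact_mod_cast Real.pi_ne_zero))
  have h4 : ((t ^ trE E : ℝ) : ℂ) ≠ 0 := by exact_mod_cast (Real.rpow_pos_of_pos ht _).ne'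
  have h5 : (2 * (Real.pi : ℂ)) ^ d * ((t ^ trE E : ℝ) : ℂ) * oscAttractor Q t x = L := by
    have h6 : renormIntegral (sublevel Q) (oscIntegrand Q t x) = ((t ^ trE E : ℝ) : ℂ)⁻¹ * L :=
      Tendsto.limUnder_eq (hL.rescale hE ht)
    rw [oscAttractor, ← oscIntegrand, h6]
    field_simp
  rw [h5]
  -- The upper cutoff is sent to infinity in the tail bound with `a` fixed.
  refine le_of_tendsto ((hL.sub_const _).norm) ?_
  filter_upwards [eventually_ge_atTop a] with b hb
  exact h a b ha hb _ hx

end osc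

/-! ### The local limit theorem at points of imaginary homogeneous type -/

theorem IsStronglySubhomogeneous.bound {U : Set (Space d)} {f : Space d → ℝ}
    {E : Space d →L[ℝ] Space d} {l : ℕ} (h : IsStronglySubhomogeneous U f E l) (ε : ℝ) (hε : 0 < ε)
    (K : Set (Space d)) (hK : IsCompact K) :
    ∃ τ : ℝ, 0 < τ ∧ ∀ t : ℝ, 0 < t → t < τ → ∀ ξ ∈ K,
      tpow t E ξ ∈ U ∧ |f (tpow t E ξ)| ≤ ε * t := by
  obtain ⟨τ, hτ, h⟩ := h.2.2 ε hε K hK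
  refine ⟨τ, hτ, fun t h1 h2 ξ hξ => ⟨(h t h1 h2 ξ hξ).1, ?_⟩⟩
  simpa using (h t h1 h2 ξ hξ).2 0 (Nat.zero_le _)

/-- The region may be described by one exponent and the rescaling by another. Their mismatch `t^{E'}
t^{-E}` preserves `P`, and such maps are uniformly bounded, so the rescaled points stay in a fixed
ball. -/
theorem scaled_norm_le_of_mem_image {P : Space d → ℝ} {E E' : Space d →L[ℝ] Space d}
    (hE : E ∈ exponentSet P) (hE' : E' ∈ exponentSet P) {C : ℝ}
    (hC : ∀ A : Space d →L[ℝ] Space d, (∀ ξ, P (A ξ) = P ξ) → ‖A‖ ≤ C) {K : Set (Space d)}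
    {ρ : ℝ} (hK : ∀ κ ∈ K, ‖κ‖ ≤ ρ) {t : ℝ} (ht : 0 < t) {z : Space d}
    (hz : z ∈ tpow t (ContinuousLinearMap.adjoint E') '' K) :
    ‖ContinuousLinearMap.adjoint (tpow t⁻¹ E) z‖ ≤ C * ρ := by
  obtain ⟨κ, hκ, rfl⟩ := hz
  have h1 : ContinuousLinearMap.adjoint (tpow t⁻¹ E) (tpow t (ContinuousLinearMap.adjoint E') κ) =
      ContinuousLinearMap.adjoint (tpow t E' ∘L tpow t⁻¹ E) κ := by
    rw [ContinuousLinearMap.adjoint_comp, adjoint_tpow t E']; rfl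
  have h2 : ‖tpow t E' ∘L tpow t⁻¹ E‖ ≤ C := hC _ fun ξ => by
    rw [ContinuousLinearMap.comp_apply, hE' t ht, hE _ (inv_pos.2 ht),
      mul_inv_cancel_left₀ ht.ne']
  rw [h1]
  refine (ContinuousLinearMap.le_opNorm _ _).trans ?_
  rw [LinearIsometryEquiv.norm_map]
  exact mul_le_mul h2 (hK κ hκ) (norm_nonneg _) ((norm_nonneg _).trans h2)

namespace GammaExpansion

variable {φ : IntLattice d → ℂ} {ξ₀ : Space d} {e : GammaExpansion φ ξ₀}

/-- For fixed `a` and large `n` both exponentials have modulus at most 1 on a set of finite measure,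
so only pointwise convergence is needed. The real part tends to 0 since `n · n^{-k} → 0`, and
subhomogeneity disposes of `n Q̃`. -/
theorem tendsto_scaled_imaginary {E : Space d →L[ℝ] Space d}
    (hQ : IsPositiveHomogeneous fun ξ => |polyFun e.Q ξ|)
    (hE : E ∈ exponentSet (polyFun e.Q)) (hc : IsContracting E) {k : ℝ} (hk : 1 < k)
    (hER : k⁻¹ • E ∈ exponentSet (polyFun e.R))
    (hsQ : IsStronglySubhomogeneous e.U e.Qt E 2)
    (hsR : IsStronglySubhomogeneous e.U e.Rt (k⁻¹ • E) 1) {δ : ℝ} (hδ : 0 < δ)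
    (hU : {ξ | |polyFun e.Q ξ| < δ} ⊆ e.U)
    (hpos : ∀ ξ, |polyFun e.Q ξ| < δ → 0 ≤ polyFun e.R ξ + e.Rt ξ) (a : ℝ) :
    Tendsto (fun n : ℕ => ∫ η in {η | |polyFun e.Q η| < a},
      ‖Complex.exp (-(n * e.phase (tpow (n : ℝ)⁻¹ E η))) -
        Complex.exp (-(Complex.I * polyFun e.Q η))‖) atTop (𝓝 0) := by
  have hk0 : 0 < k := by linarith
  have hE' : E ∈ exponentSet fun ξ => |polyFun e.Q ξ| :=
    exponentSet_abs (continuous_polyFun e.Q) ▸ hE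
  have hQc := continuous_polyFun e.Q
  have hm : MeasurableSet {η | |polyFun e.Q η| < a} :=
    measurableSet_lt hQ.continuous.measurable measurable_const
  have hfin : volume {η | |polyFun e.Q η| < a} ≠ ⊤ :=
    ((measure_mono fun ξ (h : |polyFun e.Q ξ| < a) => h.le).trans_lt
      (hQ.isCompact_le hE' hc a).measure_lt_top).ne
  have hev : ∀ᶠ n : ℕ in atTop, a < n * δ :=
    (tendsto_natCast_atTop_atTop.atTop_mul_const hδ).eventually_gt_atTop _
  have hpow : Tendsto (fun n : ℕ => (n : ℝ) ^ (1 - k)) atTop (𝓝 0) := by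
    have := (tendsto_rpow_neg_atTop (y := k - 1) (by linarith)).comp tendsto_natCast_atTop_atTop
    refine this.congr fun n => ?_
    simp
  have hn1k : ∀ n : ℕ, 0 < n → (n : ℝ) * ((n : ℝ)⁻¹ ^ k) = (n : ℝ) ^ (1 - k) := fun n hn => by
    have hn' : (0 : ℝ) < n := by exact_mod_cast hn
    rw [Real.inv_rpow hn'.le, Real.rpow_sub hn', Real.rpow_one, div_eq_mul_inv]
  rw [← integral_zero (Space d) ℝ (μ := volume.restrict {η | |polyFun e.Q η| < a})]
  refine tendsto_integral_filter_of_dominated_convergence (fun _ => 1 + 1) ?_ ?_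
    (integrableOn_const hfin) ?_
  · filter_upwards [hev, eventually_gt_atTop 0] with n h1 hn
    have hcont := ((e.continuousOn_scaled hE' hU hn).mono
      (fun η (hη : |polyFun e.Q η| < a) => hη.trans h1)).sub (s := {η | |polyFun e.Q η| < a})
      (f := fun η => Complex.exp (-(n * e.phase (tpow (n : ℝ)⁻¹ E η))))
      (g := fun η => Complex.exp (-(Complex.I * polyFun e.Q η))) (by fun_prop)
    exact hcont.norm.aestronglyMeasurable hm
  · filter_upwards [hev, eventually_gt_atTop 0] with n h1 hn
    have hn' : (0 : ℝ) < n := by exact_mod_cast hn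
    refine (ae_restrict_iff' hm).2 (Eventually.of_forall fun η hη => ?_)
    have hη : |polyFun e.Q η| < a := hη
    rw [norm_norm]
    refine (norm_sub_le _ _).trans (add_le_add ?_ (le_of_eq ?_))
    · rw [norm_exp_neg_phase, Real.exp_le_one_iff, neg_nonpos]
      refine mul_nonneg hn'.le (hpos _ ?_)
      have := hE' _ (inv_pos.2 hn') η
      simp only at this
      rw [this, inv_mul_lt_iff₀ hn']
      exact hη.trans h1
    · rw [mul_comm, ← neg_mul, ← Complex.ofReal_neg, Complex.norm_exp_ofReal_mul_I]
  · refine Eventually.of_forall fun η => ?_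
    have hRt : Tendsto (fun n : ℕ => n * e.Rt (tpow (n : ℝ)⁻¹ E η)) atTop (𝓝 0) := by
      obtain ⟨τ, hτ, hb⟩ := hsR.bound 1 one_pos {η} isCompact_singleton
      have hinv : Tendsto (fun n : ℕ => ((n : ℝ)⁻¹) ^ k) atTop (𝓝 0) := by
        have := (tendsto_rpow_neg_atTop hk0).comp tendsto_natCast_atTop_atTop
        refine this.congr fun n => ?_
        rw [Function.comp_apply, Real.inv_rpow (Nat.cast_nonneg n),
          Real.rpow_neg (Nat.cast_nonneg n)]
      refine squeeze_zero_norm' ?_ hpow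
      filter_upwards [hinv.eventually (Iio_mem_nhds hτ), eventually_gt_atTop 0] with n h1 hn
      have hn' : (0 : ℝ) < n := by exact_mod_cast hn
      have h2 := (hb _ (Real.rpow_pos_of_pos (inv_pos.2 hn') k) h1 η rfl).2
      rw [← tpow_eq_tpow_inv_smul hk0 (inv_pos.2 hn'), one_mul] at h2
      rw [norm_mul, Real.norm_of_nonneg hn'.le, Real.norm_eq_abs, ← hn1k n hn]
      gcongr
    have hQt := tendsto_mul_comp_tpow_inv hsQ.bound η
    have hlim := (((Complex.continuous_ofReal.tendsto _).comp hQt).const_mul Complex.I).add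
      (((Complex.continuous_ofReal.tendsto _).comp (hpow.mul_const (polyFun e.R η))).add
        ((Complex.continuous_ofReal.tendsto _).comp hRt)) |>.const_add (Complex.I * polyFun e.Q η)
    simp only [zero_mul, Complex.ofReal_zero, mul_zero, add_zero] at hlim
    have hlim2 := ((hlim.neg.cexp).sub_const (Complex.exp (-(Complex.I * polyFun e.Q η)))).norm
    rw [sub_self, norm_zero] at hlim2
    refine hlim2.congr' ?_
    filter_upwards [eventually_gt_atTop 0] with n hn
    have hn' : (0 : ℝ) < n := by exact_mod_cast hn
    have hnc : (n : ℂ) ≠ 0 := by exact_mod_cast hn.ne'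
    have hR1 : polyFun e.R (tpow (n : ℝ)⁻¹ E η) = (n : ℝ)⁻¹ ^ k * polyFun e.R η := by
      rw [tpow_eq_tpow_inv_smul hk0 (inv_pos.2 hn'),
        hER _ (Real.rpow_pos_of_pos (inv_pos.2 hn') k)]
    have e1 : (n : ℂ) * e.phase (tpow (n : ℝ)⁻¹ E η) = Complex.I * polyFun e.Q η +
        (Complex.I * ((n * e.Qt (tpow (n : ℝ)⁻¹ E η) : ℝ) : ℂ) +
          (((n : ℝ) ^ (1 - k) * polyFun e.R η : ℝ) +
            ((n * e.Rt (tpow (n : ℝ)⁻¹ E η) : ℝ) : ℂ))) := by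
      rw [phase, hE _ (inv_pos.2 hn'), hR1, ← hn1k n hn]
      push_cast
      field_simp
      ring
    rw [e1]
    rfl

theorem IsImaginaryType.exists_growth (h : e.IsImaginaryType) {E : Space d →L[ℝ] Space d}
    (hE : E ∈ exponentSet fun ξ => |polyFun e.Q ξ|) (hc : IsContracting E) :
    ∃ ρ : ℝ, ∀ t, 1 ≤ t → ‖tpow t E‖ ≤ ρ * √t := by
  obtain ⟨C, hC⟩ := exists_abs_polyFun_le e.Q e.Q_coeff
  obtain ⟨ρ, -, hρ⟩ := h.1.exists_norm_tpow_le_sqrt hE hc hC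
  exact ⟨ρ, hρ⟩

theorem IsImaginaryType.exists_hasRenormIntegral (h : e.IsImaginaryType)
    (hμ : homOrder (fun ξ => |polyFun e.Q ξ|) < 1) {t : ℝ} (ht : 0 < t) (x : Space d) :
    ∃ L : ℂ, HasRenormIntegral (sublevel (polyFun e.Q))
      (attractorIntegrand (fun ξ => Complex.I * (polyFun e.Q ξ : ℂ)) t x) L := by
  have h' := h
  obtain ⟨hQ, -, E, hE', -, -, -, hsQ, -⟩ := h'
  obtain ⟨ρ, hρ⟩ := h.exists_growth hE' hsQ.1
  rw [hQ.homOrder_eq hE' hsQ.1] at hμ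
  exact LocalLimit.exists_hasRenormIntegral hQ (continuous_polyFun e.Q)
    (exponentSet_abs (continuous_polyFun e.Q) ▸ hE') hsQ.1 hμ hρ ht x

theorem IsImaginaryType.local_limit (hφ : Summable fun x => ‖φ x‖)
    (hsup : IsLUB (Set.range fun ξ : Space d => ‖fourierSeries φ ξ‖) 1)
    (hΩ : Omega φ = {ξ₀}) (h : e.IsImaginaryType)
    (hμ : homOrder (fun ξ => |polyFun e.Q ξ|) < 1) {K : Set (Space d)} (hK : IsCompact K)
    {F : Space d →L[ℝ] Space d} (hF : F ∈ exponentSet (polyFun e.Q)) {ε : ℝ} (hε : 0 < ε) :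
    ∃ N : ℕ, ∀ n : ℕ, N ≤ n → ∀ x : IntLattice d,
      latticePoint x - (n : ℝ) • e.α ∈ (tpow (n : ℝ) (ContinuousLinearMap.adjoint F)) '' K →
      ‖convPow φ n x - fourierSeries φ ξ₀ ^ n * chr (-latticePoint x) ξ₀ *
        oscAttractor (polyFun e.Q) (n : ℝ) (latticePoint x - (n : ℝ) • e.α)‖
          ≤ ε * (n : ℝ) ^ (-homOrder fun ξ => |polyFun e.Q ξ|) := by
  have h' := h
  obtain ⟨hQ, hR, E, hE', k, hk, hER, hsQ, hsR⟩ := h'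
  have hQc := continuous_polyFun e.Q
  have hc := hsQ.1
  have hE : E ∈ exponentSet (polyFun e.Q) := (exponentSet_abs hQc).symm ▸ hE'
  have hF' : F ∈ exponentSet fun ξ => |polyFun e.Q ξ| := exponentSet_abs hQc ▸ hF
  obtain ⟨ρ, hρ⟩ := h.exists_growth hE' hc
  rw [hQ.homOrder_eq hE' hc] at hμ ⊢
  obtain ⟨CS, hCS⟩ := hQ.exists_norm_symmetry_le hE' hc
  obtain ⟨rK, hrK, hrK'⟩ := hK.isBounded.exists_pos_norm_le
  set r := CS * rK
  -- the neighbourhood of the origin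
  obtain ⟨C, δ₀, hC, hδ₀, hosc⟩ := exists_isOrbitOscillatory hQ hR hE hc hk hER hsQ hsR
  obtain ⟨τ, hτ, hbR⟩ := hsR.bound 1 one_pos _ hR.isCompact_level
  have hRτ : {ξ | polyFun e.R ξ < τ} ∈ 𝓝 (0 : Space d) :=
    (isOpen_lt hR.continuous continuous_const).mem_nhds (by simp [hR.map_zero, hτ])
  obtain ⟨δ₁, hδ₁, hsub₁⟩ := hQ.exists_sublevel_subset hE' hc
    (inter_mem (inter_mem (e.isOpen_U.mem_nhds e.zero_mem_U) cube_mem_nhds) hRτ)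
  -- Halving `δ₀` supplies the strict inequality `nδ < nδ₀` required by the orbit estimates.
  set δ := min δ₁ (δ₀ / 2)
  have hδ : 0 < δ := lt_min hδ₁ (half_pos hδ₀)
  have hδδ₀ : δ < δ₀ := (min_le_right _ _).trans_lt (half_lt_self hδ₀)
  have hsub : ∀ ξ, |polyFun e.Q ξ| < δ → (ξ ∈ e.U ∧ ξ ∈ cube d) ∧ polyFun e.R ξ < τ :=
    fun ξ hξ => hsub₁ (show |polyFun e.Q ξ| < δ₁ from hξ.trans_le (min_le_left _ _))
  have hU : {ξ | |polyFun e.Q ξ| < δ} ⊆ e.U := fun ξ hξ => (hsub ξ hξ).1.1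
  have hpos : ∀ ξ, |polyFun e.Q ξ| < δ → 0 ≤ polyFun e.R ξ + e.Rt ξ := fun ξ hξ => by
    have h1 := hR.le_of_polar hER e.Rt_zero (fun t h1 h2 w hw => (hbR t h1 h2 w hw).2) (hsub ξ hξ).2
    have := (abs_le.1 h1).1
    linarith
  -- tails
  obtain ⟨M₁, a₁, ha₁, hM₁, ht₁⟩ := exists_oscAttractor_approx hQ hQc hE hc hμ hρ r
  obtain ⟨M₂, a₂, ha₂, hM₂, ht₂⟩ := exists_tail_bound hQ hE' hc hμ hρ hC r
  refine (local_limit_of_scaled hφ hsup hΩ e hQ hE' hδ hU (fun ξ hξ => (hsub ξ hξ).1.2)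
    (fun n => {x | latticePoint x - (n : ℝ) • e.α ∈
      (tpow (n : ℝ) (ContinuousLinearMap.adjoint F)) '' K})
    (fun n x => oscAttractor (polyFun e.Q) (n : ℝ) (latticePoint x - (n : ℝ) • e.α))
    (fun ε' hε' => ?_) hε)
  -- The cutoff is fixed before `n`: the two tails together take half of `ε'`, and a large `n`
  -- depending on `a` makes the central part smaller than the other half.
  obtain ⟨a, hat, haa₁, haa₂⟩ := (((tendsto_const_mul_rpow_sub_one hμ (M₁ + M₂)).eventually
    (Iio_mem_nhds (half_pos hε'))).and
      ((eventually_ge_atTop a₁).and (eventually_ge_atTop a₂))).exists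
  have ha0 : 0 < a := ha₁.trans_le haa₁
  have hlim := tendsto_scaled_imaginary hQ hE hc hk hER hsQ hsR hδ hU hpos a
  have hev : ∀ᶠ n : ℕ in atTop, a < n * δ :=
    (tendsto_natCast_atTop_atTop.atTop_mul_const hδ).eventually_gt_atTop _
  obtain ⟨N, hN⟩ := (((hlim.eventually (Iio_mem_nhds (half_pos hε'))).and hev).and
    (eventually_gt_atTop 0)).exists_forall_of_atTop
  refine ⟨N, fun n hn x hx => ?_⟩
  obtain ⟨⟨hsmall, han⟩, hn0⟩ := hN n hn
  have hn' : (0 : ℝ) < n := by exact_mod_cast hn0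
  have hyr : ‖e.scaledPoint E n x‖ ≤ r :=
    scaled_norm_le_of_mem_image hE' hF' hCS hrK' hn' hx
  set y := e.scaledPoint E n x with hy
  have b₁ := ht₁ a haa₁ n hn' (latticePoint x - (n : ℝ) • e.α) hyr
  have hint := e.integrableOn_scaled hQ hE' hc hU hpos hn0 y
  have b₂ := ht₂ a (n * δ) haa₂ han.le y hyr _
    (hosc n hn0 a (n * δ) ha0 (by gcongr))
    ((e.continuousOn_scaled hE' hU hn0).mul (continuous_chr (-y)).continuousOn) hint
  have hsuba : {η | |polyFun e.Q η| < a} ⊆ {η | |polyFun e.Q η| < n * δ} :=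
    fun η (hη : |polyFun e.Q η| < a) => hη.trans han
  have b₃ : ‖(∫ η in {η | |polyFun e.Q η| < a}, e.scaledIntegrand E n y η) -
      ∫ η in {η | |polyFun e.Q η| < a}, oscIntegrand (polyFun e.Q) 1 y η‖ < ε' / 2 := by
    have hint2 : IntegrableOn (oscIntegrand (polyFun e.Q) 1 y) {η | |polyFun e.Q η| < a} :=
      ((continuous_oscIntegrand hQc 1 y).continuousOn.integrableOn_compact
        (hQ.isCompact_le hE' hc a)).mono_set fun η (hη : |polyFun e.Q η| < a) => hη.le
    rw [← integral_sub (hint.mono_set hsuba) hint2]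
    refine lt_of_le_of_lt (norm_integral_le_integral_norm _) (lt_of_le_of_lt (le_of_eq ?_) hsmall)
    refine integral_congr_ae (Eventually.of_forall fun η => ?_)
    simp only [oscIntegrand_one, scaledIntegrand]
    rw [← sub_mul, norm_mul, norm_chr, mul_one]
  have hat' : M₁ * a ^ (trE E - 1) + M₂ * a ^ (trE E - 1) < ε' / 2 := by
    rw [← add_mul]; exact hat
  -- The three differences are the tail of the rescaled integral, the central comparison on `{|Q| <
  -- a}`, and the tail of the attractor.
  have tri : ∀ p q s z : ℂ, ‖p - z‖ ≤ ‖p - q‖ + ‖q - s‖ + ‖z - s‖ := fun p q s z => by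
    have : p - z = (p - q) + (q - s) - (z - s) := by ring
    rw [this]
    exact (norm_sub_le _ _).trans (add_le_add (norm_add_le _ _) le_rfl)
  refine (tri _ (∫ η in {η | |polyFun e.Q η| < a}, e.scaledIntegrand E n y η)
    (∫ η in {η | |polyFun e.Q η| < a}, oscIntegrand (polyFun e.Q) 1 y η) _).trans ?_
  have b₁' : ‖(2 * (Real.pi : ℂ)) ^ d * (((n : ℝ) ^ trE E : ℝ) : ℂ) *
      oscAttractor (polyFun e.Q) (n : ℝ) (latticePoint x - (n : ℝ) • e.α) -
      ∫ η in {η | |polyFun e.Q η| < a}, oscIntegrand (polyFun e.Q) 1 y η‖ ≤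
        M₁ * a ^ (trE E - 1) := b₁
  have b₂' : ‖(∫ η in {η | |polyFun e.Q η| < n * δ}, e.scaledIntegrand E n y η) -
      ∫ η in {η | |polyFun e.Q η| < a}, e.scaledIntegrand E n y η‖ ≤ M₂ * a ^ (trE E - 1) := b₂
  linarith

end GammaExpansion

end LocalLimit

end

/-! ### The local limit theorem for both types -/

open LocalLimit
theorem theorem1p10 {d : ℕ} (hd : 0 < d) (φ : IntLattice d → ℂ) (hφ : MemS φ)
    (hsup : IsLUB (Set.range fun ξ : Space d => ‖fourierSeries φ ξ‖) 1)
    (ξ₀ : Space d) (hΩ : Omega φ = {ξ₀}) (e : GammaExpansion φ ξ₀) :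
    (e.IsPositiveType →
      (∀ t : ℝ, 0 < t → ∀ x : Space d, MeasureTheory.Integrable (attractorIntegrand e.P t x)) ∧
      ∀ ε : ℝ, 0 < ε → ∃ N : ℕ, ∀ n : ℕ, N ≤ n → ∀ x : IntLattice d,
        ‖convPow φ n x
          - fourierSeries φ ξ₀ ^ n
            * Complex.exp (-(Complex.I * (inner ℝ (latticePoint x) ξ₀ : ℝ)))
            * attractor e.P (n : ℝ) (latticePoint x - (n : ℝ) • e.α)‖
          ≤ ε * (n : ℝ) ^ (-homOrder (polyFun e.R))) ∧
    (e.IsImaginaryType → homOrder (fun ξ => |polyFun e.Q ξ|) < 1 →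
      (∀ t : ℝ, 0 < t → ∀ x : Space d, ∃ L : ℂ, HasRenormIntegral (sublevel (polyFun e.Q))
        (attractorIntegrand (fun ξ => Complex.I * (polyFun e.Q ξ : ℂ)) t x) L) ∧
      exponentSet (polyFun e.Q) = exponentSet (fun ξ => |polyFun e.Q ξ|) ∧
      ∀ K : Set (Space d), IsCompact K → ∀ E ∈ exponentSet (polyFun e.Q),
        ∀ ε : ℝ, 0 < ε → ∃ N : ℕ, ∀ n : ℕ, N ≤ n → ∀ x : IntLattice d,
          latticePoint x - (n : ℝ) • e.α ∈
            (tpow (n : ℝ) (ContinuousLinearMap.adjoint E)) '' K →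
          ‖convPow φ n x
            - fourierSeries φ ξ₀ ^ n
              * Complex.exp (-(Complex.I * (inner ℝ (latticePoint x) ξ₀ : ℝ)))
              * oscAttractor (polyFun e.Q) (n : ℝ) (latticePoint x - (n : ℝ) • e.α)‖
            ≤ ε * (n : ℝ) ^ (-homOrder (fun ξ => |polyFun e.Q ξ|))) := by
  have hs := hφ.summable
  simp_rw [← chr_neg_left]
  refine ⟨fun h => ⟨fun t ht x => h.integrable ht x, fun ε hε => h.local_limit hs hsup hΩ hε⟩,
    fun h hμ => ⟨fun t ht x => h.exists_hasRenormIntegral hμ ht x,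
      exponentSet_abs (continuous_polyFun e.Q), fun K hK E hE ε hε =>
        h.local_limit hs hsup hΩ hμ hK hE hε⟩⟩
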